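/- For integers $m \ge 1$ and $s_1,\dots,s_m \ge 1$, the Ramsey number $r(s_1,\dots,s_m)$ is the smallest positive integer $N$ such that every coloring of the edges of the complete graph $K_N$ with $m$ colors contains, for some color $i$, a copy of $K_{s_i}$ all of whose edges have color $i$. An $(n,d,\lambda)$-graph is a $d$-regular graph on $n$ vertices all of whose nontrivial adjacency eigenvalues (all eigenvalues, with multiplicity, except one copy of the eigenvalue $d$ belonging to the all-ones vector) have absolute value at most $\lambda$. For an integer $s \ge 3$ and a real $\alpha > 0$, we say that weakly optimal $K_s$-free $(n,d,\lambda)$-graphs with parameter $\alpha$ exist for all $n$ if there are sequences $(d_n)$ and $(\lambda_n)$ with $d_n = \Theta(n^{1-\alpha})$ and $\lambda_n = \Theta(n^{1-(s-1)\alpha})$ as $n \to \infty$ such that for every $n$ there is a $K_s$-free $(n,d_n,\lambda_n)$-graph. **Theorem.** Let $s_1,\dots,s_k \ge 3$ be integers, let $S = \sum_{i=1}^k (s_i-2)$, and suppose that for each $1 \le i \le k$ weakly optimal $K_{s_i}$-free $(n,d,\lambda)$-graphs with parameter $\alpha_i > 0$ exist for all $n$. Then there are constants $c, C > 0$, depending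 only on $S$ and $\alpha_1,\dots,\alpha_k$, such that for all integers $t \ge 2$ $$c\,\frac{t^{S+1}}{\log^{2S} t} \;\le\; r(s_1,\dots,s_k,t) \;\le\; C\,\frac{t^{S+1}}{\log^{S} t}.$$ -/

import Mathlib

open Filter Asymptotics
open scoped Matrix

/-- The `(n, d, lam)`-graphs: `d`-regular graphs on `n` vertices all of whose nontrivial eigenvalues
have absolute value at most `lam`. The trivial eigenvalue of a `d`-regular graph is the one
belonging to the all-ones vector, and it is discarded once only; as the adjacency matrix is
symmetric, the remaining eigenvalues, with multiplicity, are those of its restriction to the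
orthogonal complement of the all-ones vector, that is, to the vectors with coordinate sum `0`. -/
structure IsNDLambdaGraph {n : ℕ} (G : SimpleGraph (Fin n)) [DecidableRel G.Adj]
    (d : ℕ) (lam : ℝ) : Prop where
  regular : G.IsRegularOfDegree d
  spectral : ∀ (mu : ℝ) (v : Fin n → ℝ), v ≠ 0 → ∑ x, v x = 0 →
    G.adjMatrix ℝ *ᵥ v = mu • v → |mu| ≤ lam

open Classical in
/-- Weakly optimal `K_s`-free `(n, d, lam)`-graphs with parameter of weak optimality `α` exist for
all `n`: for every `n` there is a `K_s`-free `(n, d n, lam n)`-graph, where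
`d n = Θ(n ^ (1 - α))` and `lam n = Θ(n ^ (1 - (s - 1) α))` as `n → ∞`. -/
def WeaklyOptimalGraphsExist (s : ℕ) (α : ℝ) : Prop :=
  0 < α ∧ ∃ (d : ℕ → ℕ) (lam : ℕ → ℝ),
    (∀ n : ℕ, ∃ G : SimpleGraph (Fin n), G.CliqueFree s ∧ IsNDLambdaGraph G (d n) (lam n)) ∧
    (fun n : ℕ => (d n : ℝ)) =Θ[atTop] (fun n : ℕ => (n : ℝ) ^ (1 - α)) ∧
    lam =Θ[atTop] (fun n : ℕ => (n : ℝ) ^ (1 - ((s : ℝ) - 1) * α))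

/-- The multicolor Ramsey number `r(s_1, …, s_m)`: the smallest positive integer `N` such that in any
`m`-coloring of the edges of the complete graph on `N` vertices there is, for some color `i`, a
monochromatic `K_{s_i}` of color `i`. (If there were no such `N`, the value would be `0`, which
is never the value otherwise.) -/
noncomputable def ramseyNumber {m : ℕ} (s : Fin m → ℕ) : ℕ :=
  sInf {N : ℕ | 0 < N ∧ ∀ c : SimpleGraph.TopEdgeLabeling (Fin N) (Fin m),
    ∃ i : Fin m, ¬ (c.labelGraph i).CliqueFree (s i)}

/-! Upper bound. In a coloring without the forbidden cliques, let `H` be the union of the first `k`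
color graphs. An independent set of `H` is a clique of the last color, so `H` has none of size `t`.
Inside the color-`i` neighborhood of a vertex the bound `s i` drops by one. Induction on `S`
therefore bounds the degrees in `H` by `Δ` of order `t ^ S / log ^ (S - 1) t`, and the polynomial
Erdős–Szekeres bound, applied after two such drops, shows that each vertex lies in at most `Δ * D`
triangles with `D` of order `t ^ (S - 1)`. A graph with these local bounds has an independent set of
order `(N / Δ) * log (Δ / D)`: a random sparse subset can be made triangle-free, and there the
Ajtai–Komlós–Szemerédi bound applies (`exists_indepSet_of_few_triangles`). As `Δ / D ≥ √t`, the
logarithm has order `log t`; comparison with `t` gains one more logarithm and closes the induction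
(`IsRamseyConfig.exists_card_le`).

Lower bound. By expander mixing, a vertex set `A` of an `(n, d, λ)`-graph has at most `2 * λ * n /
d` vertices with far fewer than the expected number of neighbors in `A`. Choosing any other vertex
shrinks the set of remaining candidates by the factor `1 - d / (2 * n)`, which can happen only about
`(n / d) * log n` times. So for `t` about `(n / d) * log ^ 2 n` there are at most `(O(λ / d) * n) ^
t` sequences of `t` pairwise nonadjacent vertices. Pulling the `k` graphs back along random maps
from `N` points keeps them clique-free, and a given `t`-set is independent in all of them with
probability at most `∏ O(λ_i / d_i) ^ t`. With `n_i ^ α_i` of order `t / log ^ 2 t`, weak optimality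
makes the product of the ratios `O((log ^ 2 t / t) ^ S)`, and a union bound over the `t`-sets gives
the claim. -/

/-! ### Independent sets in triangle-free graphs -/

open Finset in
theorem two_mul_sum_powerset_card {V : Type*} [DecidableEq V] (X : Finset V) :
    2 * ∑ Y ∈ X.powerset, #Y = #X * 2 ^ #X := by
  induction X using Finset.induction with
  | empty => simp
  | insert a X ha ih =>
    rw [Finset.sum_powerset_insert ha, Finset.card_insert_of_notMem ha]
    have : ∑ Y ∈ X.powerset, #(insert a Y) = ∑ Y ∈ X.powerset, #Y + 2 ^ #X := by
      rw [← Finset.card_powerset, Finset.card_eq_sum_ones X.powerset, ← Finset.sum_add_distrib]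
      refine Finset.sum_congr rfl fun Y hY => ?_
      rw [Finset.card_insert_of_notMem fun h => ha (Finset.mem_powerset.1 hY h)]
    rw [this, pow_succ]
    linarith

/-- If `x ≥ log Δ / 2`, the term `x * 2 ^ x / 2` suffices. Otherwise `2 ^ x ≤ e ^ x ≤ √Δ`, and `log
Δ ≤ 2 * √Δ` makes the left side at most `Δ / 2`. -/
theorem log_mul_two_pow_le {Δ : ℝ} (hΔ : 1 ≤ Δ) (x : ℕ) :
    Real.log Δ / 8 * (2 ^ x + 1) ≤ Δ + x * 2 ^ x / 2 := by
  have hL : 0 ≤ Real.log Δ := Real.log_nonneg hΔ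
  have h2 : (1 : ℝ) ≤ 2 ^ x := one_le_pow₀ (by norm_num)
  have hx : (0 : ℝ) ≤ x := Nat.cast_nonneg x
  rcases le_or_gt (Real.log Δ / 2) x with h | h
  · have : Real.log Δ / 2 * 2 ^ x ≤ x * 2 ^ x := by gcongr
    nlinarith
  · have h3 : (2 : ℝ) ^ x ≤ Real.sqrt Δ := by
      have h4 : (2 : ℝ) ^ x ≤ Real.exp 1 ^ x := by
        gcongr
        linarith [Real.add_one_le_exp (1 : ℝ)]
      have h5 : Real.exp 1 ^ x ≤ Real.exp (Real.log Δ / 2) := by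
        rw [← Real.exp_nat_mul]
        apply Real.exp_le_exp.2
        linarith
      have h6 : Real.exp (Real.log Δ / 2) = Real.sqrt Δ := by
        rw [Real.sqrt_eq_rpow, Real.rpow_def_of_pos (by linarith)]
        ring_nf
      linarith
    have h7 : Real.log Δ ≤ 2 * Real.sqrt Δ := by
      have := Real.log_le_sub_one_of_pos (Real.sqrt_pos.2 (by linarith : 0 < Δ))
      rw [Real.log_sqrt (by linarith)] at this
      linarith
    have h8 := Real.sq_sqrt (by linarith : 0 ≤ Δ)
    have h9 : 0 ≤ Real.sqrt Δ := Real.sqrt_nonneg _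
    have h10 : Real.log Δ * (2 ^ x + 1) ≤ 2 * Real.sqrt Δ * (2 * Real.sqrt Δ) := by
      apply mul_le_mul h7 (by linarith) (by positivity) (by positivity)
    have : 0 ≤ x * (2 : ℝ) ^ x := by positivity
    nlinarith

open Finset in
/-- Local estimate for the uniformly random independent set: the weight that it places around
a vertex `v` with independent neighborhood has mean at least `log Δ / 8`. -/
theorem log_mul_card_indep_le {V : Type*} [DecidableEq V] (G : SimpleGraph V) [DecidableRel G.Adj]
    (U : Finset V) {Δ : ℝ} (hΔ : 1 ≤ Δ) {v : V} (hv : v ∈ U)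
    (htri : ∀ u ∈ U, ∀ w ∈ U, G.Adj v u → G.Adj v w → ¬ G.Adj u w)
    (I : Finset (Finset V)) (hI : ∀ W, W ∈ I ↔ W ⊆ U ∧ G.IsIndepSet W) :
    Real.log Δ / 8 * #I ≤
      ∑ W ∈ I, ((if v ∈ W then Δ else 0) + #{u ∈ W | G.Adj v u}) := by
  -- `g` forgets what `W` does on `v` and its neighbors. The estimate is proved on each fiber of `g`
  -- separately, that is, conditionally on the rest of `W`.
  set g : Finset V → Finset V := fun W => {u ∈ W | u ≠ v ∧ ¬ G.Adj v u} with hg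
  have key : ∀ W ∈ I, g W ∈ I := by
    intro W hW
    rw [hI] at hW ⊢
    exact ⟨(filter_subset _ _).trans hW.1, hW.2.mono (coe_subset.2 (filter_subset _ _))⟩
  rw [← sum_fiberwise_of_maps_to key, card_eq_sum_card_fiberwise key, Nat.cast_sum, mul_sum]
  refine sum_le_sum fun H hH => ?_
  by_cases hgH : g H = H
  swap
  · rw [filter_eq_empty_iff.2]
    · simp
    · rintro W - rfl
      apply hgH
      ext u
      simp only [hg, mem_filter]
      tauto
  have hH1 : ∀ u ∈ H, u ≠ v ∧ ¬ G.Adj v u := by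
    intro u hu
    rw [← hgH] at hu
    exact (mem_filter.1 hu).2
  obtain ⟨hHU, hHi⟩ := (hI H).1 hH
  set X : Finset V := {u ∈ U | G.Adj v u ∧ ∀ h ∈ H, ¬ G.Adj u h} with hX
  have hXH : Disjoint X H := by
    rw [disjoint_left]
    intro u hu hu'
    exact (hH1 u hu').2 (mem_filter.1 hu).2.1
  -- Given the rest `H`, either `v` is added, or any subset of the neighbors `X` not blocked by `H`;
  -- all of these are allowed because the neighborhood of `v` is independent. The fiber has `2 ^ #X
  -- + 1` members.
  have hfib : I.filter (fun W => g W = H) =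
      insert (insert v H) (X.powerset.image (fun Y => H ∪ Y)) := by
    ext W
    simp only [mem_filter, mem_insert, mem_image, mem_powerset]
    constructor
    · rintro ⟨hW, hWH⟩
      obtain ⟨hWU, hWi⟩ := (hI W).1 hW
      by_cases hvW : v ∈ W
      · left
        rw [← hWH]
        ext u
        simp only [hg, mem_insert, mem_filter]
        constructor
        · intro hu
          by_cases huv : u = v
          · exact Or.inl huv
          · exact Or.inr ⟨hu, huv, hWi hvW hu (Ne.symm huv)⟩
        · rintro (rfl | h)
          · exact hvW
          · exact h.1
      · right
        refine ⟨{u ∈ W | G.Adj v u}, ?_, ?_⟩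
        · intro u hu
          rw [mem_filter] at hu
          rw [hX, mem_filter]
          refine ⟨hWU hu.1, hu.2, fun h hh => ?_⟩
          have hhW : h ∈ W := by
            rw [← hWH] at hh
            exact (mem_filter.1 hh).1
          refine hWi hu.1 hhW ?_
          rintro rfl
          exact (hH1 _ hh).2 hu.2
        · rw [← hWH]
          ext u
          simp only [hg, mem_union, mem_filter]
          constructor
          · rintro (h | h) <;> exact h.1
          · intro hu
            have : u ≠ v := by rintro rfl; exact hvW hu
            tauto
    · rintro (rfl | ⟨Y, hY, rfl⟩)
      · refine ⟨(hI _).2 ⟨insert_subset hv hHU, ?_⟩, ?_⟩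
        · rw [coe_insert]
          intro a ha b hb hab
          rcases ha with rfl | ha <;> rcases hb with rfl | hb
          · exact absurd rfl hab
          · exact (hH1 b hb).2
          · exact fun h => (hH1 a ha).2 h.symm
          · exact hHi ha hb hab
        · ext u
          simp only [hg, mem_filter, mem_insert]
          constructor
          · tauto
          · intro hu
            exact ⟨Or.inr hu, hH1 u hu⟩
      · have hYX : ∀ u ∈ Y, u ∈ U ∧ G.Adj v u ∧ ∀ h ∈ H, ¬ G.Adj u h := by
          intro u hu
          simpa [hX] using hY hu
        refine ⟨(hI _).2 ⟨union_subset hHU fun u hu => (hYX u hu).1, ?_⟩, ?_⟩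
        · rw [coe_union]
          intro a ha b hb hab
          rcases ha with ha | ha <;> rcases hb with hb | hb
          · exact hHi ha hb hab
          · exact fun h => (hYX b hb).2.2 a ha h.symm
          · exact (hYX a ha).2.2 b hb
          · exact htri a (hYX a ha).1 b (hYX b hb).1 (hYX a ha).2.1 (hYX b hb).2.1
        · ext u
          simp only [hg, mem_filter, mem_union]
          constructor
          · rintro ⟨h | h, h1⟩
            · exact h
            · exact absurd (hYX u h).2.1 h1.2
          · intro hu
            exact ⟨Or.inl hu, hH1 u hu⟩
  have hvH : v ∉ H := fun h => (hH1 v h).1 rfl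
  have hnot : insert v H ∉ X.powerset.image (fun Y => H ∪ Y) := by
    simp only [mem_image, mem_powerset, not_exists, not_and]
    intro Y hY h
    have : v ∈ H ∪ Y := h ▸ mem_insert_self v H
    rcases mem_union.1 this with h' | h'
    · exact hvH h'
    · exact G.irrefl (mem_filter.1 (hY h')).2.1
  have hinj : Set.InjOn (fun Y => H ∪ Y) (X.powerset : Set (Finset V)) := by
    intro Y hY Z hZ h
    simp only [coe_powerset, Set.mem_preimage, Set.mem_powerset_iff, coe_subset] at hY hZ
    have hd : ∀ Y ⊆ X, (H ∪ Y) \ H = Y := fun Y hY =>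
      union_sdiff_cancel_left (hXH.mono_left hY).symm
    rw [← hd Y hY, ← hd Z hZ]
    exact congrArg (· \ H) h
  rw [hfib, card_insert_of_notMem hnot, card_image_of_injOn hinj, card_powerset,
    sum_insert hnot, sum_image hinj]
  have h1 : (Δ : ℝ) ≤ (if v ∈ insert v H then Δ else 0) + #{u ∈ insert v H | G.Adj v u} := by
    simp
  have h2 : ∑ Y ∈ X.powerset, (#Y : ℝ) ≤ ∑ Y ∈ X.powerset,
      ((if v ∈ H ∪ Y then Δ else 0) + #{u ∈ H ∪ Y | G.Adj v u}) := by
    refine sum_le_sum fun Y hY => ?_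
    have : (#Y : ℝ) ≤ #{u ∈ H ∪ Y | G.Adj v u} := by
      refine Nat.cast_le.2 (card_le_card fun u hu => ?_)
      rw [mem_filter]
      exact ⟨mem_union_right _ hu, (mem_filter.1 (mem_powerset.1 hY hu)).2.1⟩
    have h3 : (0 : ℝ) ≤ if v ∈ H ∪ Y then Δ else 0 := by split_ifs <;> linarith
    linarith
  have h3 := log_mul_two_pow_le hΔ #X
  have h4 : (2 : ℝ) * ∑ Y ∈ X.powerset, (#Y : ℝ) = #X * 2 ^ #X := by
    exact_mod_cast two_mul_sum_powerset_card X
  push_cast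
  linarith

open Finset in
/-- Ajtai, Komlós and Szemerédi: triangle-free graphs of bounded degree have large
independent sets. -/
theorem exists_indepSet_of_triangleFree {V : Type*} [DecidableEq V] (G : SimpleGraph V)
    [DecidableRel G.Adj] (U : Finset V) {Δ : ℝ} (hΔ : 1 ≤ Δ)
    (hdeg : ∀ v ∈ U, (#{u ∈ U | G.Adj v u} : ℝ) ≤ Δ)
    (htri : ∀ v ∈ U, ∀ u ∈ U, ∀ w ∈ U, G.Adj v u → G.Adj v w → ¬ G.Adj u w) :
    ∃ W ⊆ U, G.IsIndepSet W ∧ #U * (Real.log Δ / (16 * Δ)) ≤ #W := by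
  classical
  set I : Finset (Finset V) := {W ∈ U.powerset | G.IsIndepSet (W : Set V)} with hIdef
  have hI : ∀ W, W ∈ I ↔ W ⊆ U ∧ G.IsIndepSet (W : Set V) := by simp [hIdef]
  have hne : I.Nonempty := ⟨∅, by rw [hI]; simp [SimpleGraph.isIndepSet_iff]⟩
  -- Double counting: summed over `v`, each of the two weights contributes at most `Δ * #W`, the
  -- second because every member of `W` has at most `Δ` neighbors in `U`.
  have h1 : ∑ W ∈ I, (#U * (Real.log Δ / 8) : ℝ) ≤ ∑ W ∈ I, 2 * Δ * #W := by
    calc ∑ W ∈ I, (#U * (Real.log Δ / 8) : ℝ) = ∑ v ∈ U, Real.log Δ / 8 * #I := by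
          simp only [sum_const, nsmul_eq_mul]; ring
      _ ≤ ∑ v ∈ U, ∑ W ∈ I, ((if v ∈ W then Δ else 0) + #{u ∈ W | G.Adj v u}) :=
          sum_le_sum fun v hv => log_mul_card_indep_le G U hΔ hv (htri v hv) I hI
      _ = ∑ W ∈ I, ∑ v ∈ U, ((if v ∈ W then Δ else 0) + #{u ∈ W | G.Adj v u}) := sum_comm
      _ ≤ _ := by
          refine sum_le_sum fun W hW => ?_
          have hWU := ((hI W).1 hW).1
          have ha : ∑ v ∈ U, (if v ∈ W then Δ else 0) = Δ * #W := by
            rw [← sum_filter, filter_mem_eq_inter, inter_eq_right.2 hWU, sum_const, nsmul_eq_mul,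
              mul_comm]
          have hb : ∑ v ∈ U, (#{u ∈ W | G.Adj v u} : ℝ) ≤ Δ * #W := by
            have := sum_card_bipartiteAbove_eq_sum_card_bipartiteBelow (s := U) (t := W) G.Adj
            simp only [bipartiteAbove, bipartiteBelow] at this
            calc ∑ v ∈ U, (#{u ∈ W | G.Adj v u} : ℝ) = ∑ u ∈ W, (#{v ∈ U | G.Adj v u} : ℝ) := by
                  exact_mod_cast this
              _ ≤ ∑ u ∈ W, Δ := by
                  refine sum_le_sum fun u hu => ?_
                  simpa only [G.adj_comm] using hdeg u (hWU hu)
              _ = Δ * #W := by rw [sum_const, nsmul_eq_mul, mul_comm]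
          rw [sum_add_distrib, ha]
          linarith
  obtain ⟨W, hW, h⟩ := exists_le_of_sum_le hne h1
  refine ⟨W, ((hI W).1 hW).1, ((hI W).1 hW).2, ?_⟩
  have : (#U * (Real.log Δ / (16 * Δ)) : ℝ) = #U * (Real.log Δ / 8) / (2 * Δ) := by
    field_simp; ring
  rw [this, div_le_iff₀ (by linarith)]
  linarith

/-! ### Random sparsification and graphs with few triangles -/

-- The zero set of a uniformly random function to `Fin q` models a random subset that contains each
-- point independently with probability `1 / q`.
open Finset in
theorem card_fun_eq_zero_on_mul {V : Type*} [Fintype V] [DecidableEq V] (q : ℕ) [NeZero q]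
    (T : Finset V) :
    #{χ : V → Fin q | ∀ a ∈ T, χ a = 0} * q ^ #T = q ^ Fintype.card V := by
  have h : ({χ : V → Fin q | ∀ a ∈ T, χ a = 0} : Finset (V → Fin q)) =
      Fintype.piFinset fun a => if a ∈ T then {0} else univ := by
    ext χ
    simp only [mem_filter, mem_univ, true_and, Fintype.mem_piFinset]
    refine forall_congr' fun a => ?_
    split_ifs with ha <;> simp [ha]
  rw [h, Fintype.card_piFinset]
  have : ∀ a, #(if a ∈ T then ({0} : Finset (Fin q)) else univ) = if a ∈ T then 1 else q := by
    intro a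
    split_ifs <;> simp
  simp only [this]
  have h2 : q ^ #T = ∏ a, if a ∈ T then q else 1 := by
    rw [prod_ite_mem, univ_inter, prod_const]
  rw [h2, ← prod_mul_distrib]
  have : ∀ a : V, ((if a ∈ T then 1 else q) * if a ∈ T then q else 1) = q := by
    intro a
    split_ifs <;> simp
  simp [this]

open Finset in
/-- Double counting of the members of a family of `m`-sets on which a random function to `Fin q`
vanishes. -/
theorem sum_card_filter_eq_zero_on {V β : Type*} [Fintype V] [DecidableEq V] (q : ℕ) [NeZero q]
    (E : Finset β) (f : β → Finset V) {m : ℕ} (hm : ∀ e ∈ E, #(f e) = m) :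
    ∑ χ : V → Fin q, (#{e ∈ E | ∀ a ∈ f e, χ a = 0} : ℝ) =
      #E * ((q : ℝ) ^ Fintype.card V / (q : ℝ) ^ m) := by
  have h := sum_card_bipartiteAbove_eq_sum_card_bipartiteBelow (s := (univ : Finset (V → Fin q)))
    (t := E) (fun χ e => ∀ a ∈ f e, χ a = 0)
  simp only [bipartiteAbove, bipartiteBelow] at h
  have hq : (q : ℝ) ≠ 0 := Nat.cast_ne_zero.2 (NeZero.ne q)
  calc ∑ χ : V → Fin q, (#{e ∈ E | ∀ a ∈ f e, χ a = 0} : ℝ)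
      = ∑ e ∈ E, (#{χ : V → Fin q | ∀ a ∈ f e, χ a = 0} : ℝ) := by exact_mod_cast h
    _ = ∑ e ∈ E, ((q : ℝ) ^ Fintype.card V / (q : ℝ) ^ m) := by
        refine sum_congr rfl fun e he => ?_
        rw [eq_div_iff (pow_ne_zero _ hq), ← hm e he]
        exact_mod_cast card_fun_eq_zero_on_mul q (f e)
    _ = _ := by rw [sum_const, nsmul_eq_mul]

open Finset in
/-- A sparse random subset of a graph with few triangles contains, after deletions, a large set
that is triangle-free and of small degree. -/
theorem exists_triangleFree_subset {V : Type*} [Fintype V] [DecidableEq V] (G : SimpleGraph V)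
    [DecidableRel G.Adj] (U : Finset V) {Δ D : ℝ} (hΔ : 0 < Δ) (q : ℕ) [NeZero q]
    (hq : 4 * (Δ * D) ≤ (q : ℝ) ^ 2)
    (hdeg : ∀ v ∈ U, (#{u ∈ U | G.Adj v u} : ℝ) ≤ Δ)
    (htri : ∀ v ∈ U, (#{p ∈ U ×ˢ U | G.Adj v p.1 ∧ G.Adj v p.2 ∧ G.Adj p.1 p.2} : ℝ) ≤ Δ * D) :
    ∃ W ⊆ U, (∀ v ∈ W, (#{u ∈ W | G.Adj v u} : ℝ) ≤ 4 * Δ / q) ∧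
      (∀ v ∈ W, ∀ u ∈ W, ∀ w ∈ W, G.Adj v u → G.Adj v w → ¬ G.Adj u w) ∧
      #U / (2 * q : ℝ) ≤ #W := by
  have hq0 : (0 : ℝ) < q := Nat.cast_pos.2 (Nat.pos_of_ne_zero (NeZero.ne q))
  set E : Finset (V × V) := {p ∈ U ×ˢ U | G.Adj p.1 p.2} with hE
  set T : Finset (V × V × V) :=
    {p ∈ U ×ˢ (U ×ˢ U) | G.Adj p.1 p.2.1 ∧ G.Adj p.1 p.2.2 ∧ G.Adj p.2.1 p.2.2} with hT
  have hEc : (#E : ℝ) ≤ #U * Δ := by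
    have : #E = ∑ v ∈ U, #{u ∈ U | G.Adj v u} := by
      rw [hE, card_filter, sum_product]
      simp only [card_filter]
    rw [this]
    push_cast
    calc _ ≤ ∑ v ∈ U, Δ := sum_le_sum hdeg
      _ = _ := by rw [sum_const, nsmul_eq_mul]
  have hTc : (#T : ℝ) ≤ #U * (Δ * D) := by
    have : #T = ∑ v ∈ U, #{p ∈ U ×ˢ U | G.Adj v p.1 ∧ G.Adj v p.2 ∧ G.Adj p.1 p.2} := by
      rw [hT, card_filter, sum_product]
      simp only [card_filter]
    rw [this]
    push_cast
    calc _ ≤ ∑ v ∈ U, Δ * D := sum_le_sum htri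
      _ = _ := by rw [sum_const, nsmul_eq_mul]
  have s1 := sum_card_filter_eq_zero_on (V := V) q U (fun v => {v}) (m := 1) (by simp)
  have s2 := sum_card_filter_eq_zero_on (V := V) q E (fun p => {p.1, p.2}) (m := 2) (by
    intro p hp
    exact card_pair (mem_filter.1 hp).2.ne)
  have s3 := sum_card_filter_eq_zero_on (V := V) q T (fun p => {p.1, p.2.1, p.2.2}) (m := 3) (by
    intro p hp
    have h := (mem_filter.1 hp).2
    exact card_eq_three.2 ⟨_, _, _, h.1.ne, h.2.1.ne, h.2.2.ne, rfl⟩)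
  set Q : ℝ := (q : ℝ) ^ Fintype.card V with hQ
  have hQ0 : 0 < Q := by positivity
  -- In expectation `#U / q` vertices are kept. Triangles cost at most `#U / (4 * q)` by `hq`, and
  -- by Markov's inequality so do the vertices of degree above `4 * Δ / q`, four times the expected
  -- bound.
  have hsum : ∑ χ : V → Fin q, (#U / (2 * q : ℝ)) ≤
      ∑ χ : V → Fin q, ((#{v ∈ U | ∀ a ∈ ({v} : Finset V), χ a = 0} : ℝ) -
        #{p ∈ T | ∀ a ∈ ({p.1, p.2.1, p.2.2} : Finset V), χ a = 0} -
        #{p ∈ E | ∀ a ∈ ({p.1, p.2} : Finset V), χ a = 0} / (4 * Δ / q)) := by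
    rw [sum_sub_distrib, sum_sub_distrib, ← sum_div univ fun χ : V → Fin q =>
      (#{p ∈ E | ∀ a ∈ ({p.1, p.2} : Finset V), χ a = 0} : ℝ), s1, s2, s3]
    simp only [sum_const, card_univ, Fintype.card_fun, Fintype.card_fin, nsmul_eq_mul]
    push_cast
    rw [← hQ]
    have e3 : (#T : ℝ) * (Q / q ^ 3) ≤ #U * Q / (4 * q) := by
      calc (#T : ℝ) * (Q / q ^ 3) ≤ #U * (Δ * D) * (Q / q ^ 3) := by gcongr
        _ = #U * Q / (4 * q) * (4 * (Δ * D) / q ^ 2) := by field_simp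
        _ ≤ #U * Q / (4 * q) * 1 := by
            gcongr
            rw [div_le_one (by positivity)]
            exact hq
        _ = _ := mul_one _
    have e2 : (#E : ℝ) * (Q / q ^ 2) / (4 * Δ / q) ≤ #U * Q / (4 * q) := by
      calc (#E : ℝ) * (Q / q ^ 2) / (4 * Δ / q) ≤ #U * Δ * (Q / q ^ 2) / (4 * Δ / q) := by gcongr
        _ = _ := by field_simp
    have e1 : (Q : ℝ) * (#U / (2 * q)) = #U * (Q / q ^ 1) - #U * Q / (4 * q) - #U * Q / (4 * q) := by
      field_simp; ring
    linarith
  obtain ⟨χ, -, hχ⟩ := exists_le_of_sum_le univ_nonempty hsum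
  simp only [mem_insert, mem_singleton, forall_eq, forall_eq_or_imp] at hχ
  set A : Finset V := {v ∈ U | χ v = 0} with hA
  set T' : Finset (V × V × V) := {p ∈ T | χ p.1 = 0 ∧ χ p.2.1 = 0 ∧ χ p.2.2 = 0} with hT'
  set E' : Finset (V × V) := {p ∈ E | χ p.1 = 0 ∧ χ p.2 = 0} with hE'
  set B : Finset V := {v ∈ A | 4 * Δ / q < (#{u ∈ A | G.Adj v u} : ℝ)} with hB
  have hBc : (#B : ℝ) ≤ #E' / (4 * Δ / q) := by
    rw [le_div_iff₀ (by positivity)]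
    have h1 : ∑ v ∈ A, #{u ∈ A | G.Adj v u} = #E' := by
      have : E' = {p ∈ A ×ˢ A | G.Adj p.1 p.2} := by
        ext p
        simp only [hE', hE, hA, mem_filter, mem_product]
        tauto
      rw [this, card_filter, sum_product]
      simp only [card_filter]
    rw [← h1]
    push_cast
    calc (#B : ℝ) * (4 * Δ / q) = ∑ v ∈ B, 4 * Δ / q := by rw [sum_const, nsmul_eq_mul]
      _ ≤ ∑ v ∈ B, (#{u ∈ A | G.Adj v u} : ℝ) :=
          sum_le_sum fun v hv => (mem_filter.1 hv).2.le
      _ ≤ _ := sum_le_sum_of_subset_of_nonneg (filter_subset _ _) fun _ _ _ => Nat.cast_nonneg _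
  have hTc' : (#(T'.image Prod.fst) : ℝ) ≤ #T' := Nat.cast_le.2 card_image_le
  refine ⟨(A \ T'.image Prod.fst) \ B, ?_, ?_, ?_, ?_⟩
  · exact (sdiff_subset.trans sdiff_subset).trans (filter_subset _ _)
  · intro v hv
    have hv' : v ∈ A ∧ v ∉ B := by
      simp only [Finset.mem_sdiff] at hv
      exact ⟨hv.1.1, hv.2⟩
    have : ¬ 4 * Δ / q < (#{u ∈ A | G.Adj v u} : ℝ) := fun h => hv'.2 (mem_filter.2 ⟨hv'.1, h⟩)
    refine le_trans (Nat.cast_le.2 (card_le_card ?_)) (not_lt.1 this)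
    exact filter_subset_filter _ (sdiff_subset.trans sdiff_subset)
  · intro v hv u hu w hw hvu hvw huw
    simp only [Finset.mem_sdiff, mem_image, not_exists, not_and] at hv hu hw
    have h1 := mem_filter.1 hv.1.1
    have h2 := mem_filter.1 hu.1.1
    have h3 := mem_filter.1 hw.1.1
    refine hv.1.2 (v, u, w) ?_ rfl
    simp only [hT', hT, mem_filter, mem_product]
    exact ⟨⟨⟨h1.1, h2.1, h3.1⟩, hvu, hvw, huw⟩, h1.2, h2.2, h3.2⟩
  · have k1 : (#(A \ T'.image Prod.fst) : ℝ) ≥ #A - #(T'.image Prod.fst) := by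
      have := le_card_sdiff (T'.image Prod.fst) A
      have h : #A ≤ #(A \ T'.image Prod.fst) + #(T'.image Prod.fst) := by omega
      have : (#A : ℝ) ≤ #(A \ T'.image Prod.fst) + #(T'.image Prod.fst) := by exact_mod_cast h
      linarith
    have k2 : (#((A \ T'.image Prod.fst) \ B) : ℝ) ≥ #(A \ T'.image Prod.fst) - #B := by
      have := le_card_sdiff B (A \ T'.image Prod.fst)
      have h : #(A \ T'.image Prod.fst) ≤ #((A \ T'.image Prod.fst) \ B) + #B := by omega
      have : (#(A \ T'.image Prod.fst) : ℝ) ≤ #((A \ T'.image Prod.fst) \ B) + #B := by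
        exact_mod_cast h
      linarith
    linarith

open Finset in
/-- Graphs of bounded degree in which every vertex lies in few triangles have large
independent sets. -/
theorem exists_indepSet_of_few_triangles {V : Type*} [Fintype V] [DecidableEq V]
    (G : SimpleGraph V) [DecidableRel G.Adj] (U : Finset V) {Δ D : ℝ} (hD : 1 ≤ D) (hDΔ : D ≤ Δ)
    (hdeg : ∀ v ∈ U, (#{u ∈ U | G.Adj v u} : ℝ) ≤ Δ)
    (htri : ∀ v ∈ U, (#{p ∈ U ×ˢ U | G.Adj v p.1 ∧ G.Adj v p.2 ∧ G.Adj p.1 p.2} : ℝ) ≤ Δ * D) :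
    ∃ W ⊆ U, G.IsIndepSet W ∧ #U * (Real.log (Δ / D) / (256 * Δ)) ≤ #W := by
  have hD0 : 0 < D := by linarith
  have hΔ0 : 0 < Δ := by linarith
  set r : ℝ := Real.sqrt (Δ * D) with hr
  have hr2 : r ^ 2 = Δ * D := Real.sq_sqrt (by positivity)
  have hr1 : 1 ≤ r := by
    rw [hr, Real.one_le_sqrt]
    nlinarith
  have hrΔ : r ≤ Δ := by
    rw [hr, Real.sqrt_le_left hΔ0.le]
    nlinarith
  -- Up to rounding, this is the smallest `q` with `4 * Δ * D ≤ q ^ 2`. The remaining degree bound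
  -- `4 * Δ / q` is then still at least `√(Δ / D)`.
  set q : ℕ := ⌈2 * r⌉₊ with hqdef
  have hq1 : 2 * r ≤ q := Nat.le_ceil _
  have hq2 : (q : ℝ) ≤ 3 * r := by
    have := (Nat.ceil_lt_add_one (by linarith : 0 ≤ 2 * r)).le
    linarith
  have hqpos : (0 : ℝ) < q := by linarith
  have : NeZero q := ⟨fun h => by rw [h] at hqpos; simp at hqpos⟩
  obtain ⟨A, hAU, hAdeg, hAtri, hAcard⟩ := exists_triangleFree_subset G U hΔ0 q
    (by nlinarith) hdeg htri
  have hge : Δ / r ≤ 4 * Δ / q := by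
    rw [div_le_div_iff₀ (by linarith) hqpos]
    nlinarith
  have h1 : 1 ≤ Δ / r := by rw [le_div_iff₀ (by linarith)]; linarith
  obtain ⟨W, hWA, hWi, hWc⟩ := exists_indepSet_of_triangleFree G A (h1.trans hge) hAdeg hAtri
  refine ⟨W, hWA.trans hAU, hWi, le_trans ?_ hWc⟩
  have hlog : Real.log (Δ / D) / 2 ≤ Real.log (4 * Δ / q) := by
    have h2 : Real.log (Δ / D) / 2 = Real.log (Δ / r) := by
      have : Δ / D = (Δ / r) ^ 2 := by
        rw [div_pow, hr2]
        field_simp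
      rw [this, Real.log_pow]
      push_cast
      ring
    rw [h2]
    exact Real.log_le_log (by linarith) hge
  have hlog0 : 0 ≤ Real.log (4 * Δ / q) := Real.log_nonneg (h1.trans hge)
  calc #U * (Real.log (Δ / D) / (256 * Δ)) = #U * ((Real.log (Δ / D) / 2) / (128 * Δ)) := by
        field_simp; ring
    _ ≤ #U * (Real.log (4 * Δ / q) / (128 * Δ)) := by gcongr
    _ = #U / (2 * q : ℝ) * (Real.log (4 * Δ / q) / (16 * (4 * Δ / q))) := by
        field_simp; ring
    _ ≤ #A * (Real.log (4 * Δ / q) / (16 * (4 * Δ / q))) := by gcongr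

/-! ### Ramsey configurations: degrees, codegrees and triangles -/

/-- A set `U` of vertices on which, for every color `i`, the graph `G i` has no clique of size
`s i`, and the union of these graphs has no independent set of size `t`. -/
structure IsRamseyConfig {ι V : Type*} (G : ι → SimpleGraph V) (s : ι → ℕ) (t : ℕ)
    (U : Finset V) : Prop where
  cliqueFreeOn : ∀ i, (G i).CliqueFreeOn U (s i)
  card_lt : ∀ W ⊆ U, (⨆ i, G i).IsIndepSet (W : Set V) → W.card < t

section Config

variable {ι V : Type*} {G : ι → SimpleGraph V} {s : ι → ℕ} {t : ℕ} {U : Finset V}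

theorem SimpleGraph.CliqueFreeOn.pred_of_adj {H : SimpleGraph V} {n : ℕ} {A B : Set V} {v : V}
    (h : H.CliqueFreeOn A n) (hv : v ∈ A) (hBA : B ⊆ A) (hB : ∀ w ∈ B, H.Adj v w) :
    H.CliqueFreeOn B (n - 1) := by
  cases n with
  | zero => exact absurd (SimpleGraph.isNClique_empty.2 rfl) (h (t := ∅) (by simp))
  | succ n => exact (h.of_succ H hv).subset H (by
      intro w hw
      exact ⟨hBA hw, hB w hw⟩)

theorem SimpleGraph.CliqueFreeOn.eq_empty {H : SimpleGraph V} {A : Finset V}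
    (h : H.CliqueFreeOn A 1) : A = ∅ := by
  rw [Finset.eq_empty_iff_forall_notMem]
  intro v hv
  exact h (t := {v}) (by simpa using hv) (SimpleGraph.isNClique_singleton.2 rfl)

theorem SimpleGraph.CliqueFreeOn.not_adj {H : SimpleGraph V} {A : Set V}
    (h : H.CliqueFreeOn A 2) {v w : V} (hv : v ∈ A) (hw : w ∈ A) : ¬ H.Adj v w := fun hvw =>
  (SimpleGraph.cliqueFreeOn_two H).1 h hv hw hvw.ne hvw

namespace IsRamseyConfig

theorem subset (h : IsRamseyConfig G s t U) {U' : Finset V} (hU : U' ⊆ U) :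
    IsRamseyConfig G s t U' :=
  ⟨fun i => (h.cliqueFreeOn i).subset _ (Finset.coe_subset.2 hU),
    fun W hW => h.card_lt W (hW.trans hU)⟩

theorem pos (h : IsRamseyConfig G s t U) : 0 < t :=
  h.card_lt ∅ (Finset.empty_subset _) (by simp [SimpleGraph.isIndepSet_iff])

theorem update_of_cliqueFreeOn [DecidableEq ι] (h : IsRamseyConfig G s t U) {i : ι} {n : ℕ}
    (hi : (G i).CliqueFreeOn U n) : IsRamseyConfig G (Function.update s i n) t U := by
  refine ⟨fun j => ?_, h.card_lt⟩
  rcases eq_or_ne j i with rfl | hj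
  · simpa using hi
  · simpa [Function.update_of_ne hj] using h.cliqueFreeOn j

/-- Passing to neighbors of `v` in color `i` lowers the clique bound of color `i`. -/
theorem pred [DecidableEq ι] (h : IsRamseyConfig G s t U) {v : V} (hv : v ∈ U) {i : ι}
    {U' : Finset V} (hU : U' ⊆ U) (hadj : ∀ w ∈ U', (G i).Adj v w) :
    IsRamseyConfig G (Function.update s i (s i - 1)) t U' :=
  (h.subset hU).update_of_cliqueFreeOn
    ((h.cliqueFreeOn i).pred_of_adj hv (Finset.coe_subset.2 hU) hadj)

theorem pred_pred [DecidableEq ι] (h : IsRamseyConfig G s t U) {u v : V} (hu : u ∈ U) (hv : v ∈ U)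
    {j l : ι} {U' : Finset V} (hU : U' ⊆ U) (hj : ∀ w ∈ U', (G j).Adj v w)
    (hl : ∀ w ∈ U', (G l).Adj u w) :
    IsRamseyConfig G (Function.update (Function.update s j (s j - 1)) l (s l - 1)) t U' :=
  (h.pred hv hU hj).update_of_cliqueFreeOn
    ((h.cliqueFreeOn l).pred_of_adj hu (Finset.coe_subset.2 hU) hl)

end IsRamseyConfig

/-- The quantity `∑ (s j - 2)` is the induction parameter. With `3 ≤ s i` the truncated subtraction
does not hide the drop. -/
theorem sum_update_sub_two [Fintype ι] [DecidableEq ι] {i : ι} (hi : 3 ≤ s i) :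
    ∑ j, (Function.update s i (s i - 1) j - 2) + 1 = ∑ j, (s j - 2) := by
  rw [← Finset.add_sum_erase _ _ (Finset.mem_univ i),
    ← Finset.add_sum_erase _ (fun j => s j - 2) (Finset.mem_univ i), Function.update_self,
    Finset.sum_congr rfl fun j hj => by rw [Function.update_of_ne (Finset.ne_of_mem_erase hj)]]
  omega

theorem two_le_update [DecidableEq ι] (hs : ∀ j, 2 ≤ s j) {i : ι} {n : ℕ} (hn : 2 ≤ n) :
    ∀ j, 2 ≤ Function.update s i n j := by
  intro j
  rcases eq_or_ne j i with rfl | hj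
  · simpa using hn
  · simpa [Function.update_of_ne hj] using hs j

open Classical in
/-- Degree bound in terms of a bound for the configurations with one clique bound lowered. -/
theorem IsRamseyConfig.degree_le [Fintype ι] (h : IsRamseyConfig G s t U) (hs : ∀ i, 2 ≤ s i)
    {B : ℕ} (hB : ∀ i, 3 ≤ s i → ∀ U' ⊆ U,
      IsRamseyConfig G (Function.update s i (s i - 1)) t U' → U'.card ≤ B)
    {v : V} (hv : v ∈ U) :
    (U.filter fun u => (⨆ i, G i).Adj v u).card ≤ Fintype.card ι * B := by
  have : (U.filter fun u => (⨆ i, G i).Adj v u) ⊆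
      Finset.univ.biUnion fun i => U.filter fun u => (G i).Adj v u := by
    intro u hu
    simpa [SimpleGraph.iSup_adj] using hu
  refine (Finset.card_le_card this).trans (Finset.card_biUnion_le_card_mul _ _ _ fun i _ => ?_)
  have hc := h.pred (U' := U.filter fun u => (G i).Adj v u) hv (i := i) (Finset.filter_subset _ _)
    fun w hw => (Finset.mem_filter.1 hw).2
  -- A color with `s i = 2` has no edges: its clique bound drops to `1`, which leaves no vertex at
  -- all.
  rcases (hs i).eq_or_lt with hi | hi
  · have h1 := hc.cliqueFreeOn i
    rw [Function.update_self, ← hi] at h1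
    rw [h1.eq_empty]
    simp
  · exact hB i hi _ (Finset.filter_subset _ _) hc

open Classical in
/-- Greedy bound for the size of a vertex set by the degrees and the independence number. -/
theorem card_le_mul_of_degree_le (H : SimpleGraph V) (U : Finset V) {t Δ : ℕ}
    (hdeg : ∀ v ∈ U, (U.filter fun u => H.Adj v u).card ≤ Δ)
    (hind : ∀ W ⊆ U, H.IsIndepSet (W : Set V) → W.card < t) : U.card ≤ t * (Δ + 1) := by
  obtain ⟨W, hW, hmax⟩ := Finset.exists_max_image
    (U.powerset.filter fun W : Finset V => H.IsIndepSet (W : Set V)) Finset.card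
    ⟨∅, by simp [SimpleGraph.isIndepSet_iff]⟩
  simp only [Finset.mem_filter, Finset.mem_powerset] at hW hmax
  -- An independent set of maximum size dominates `U`.
  have hsub : U ⊆ W.biUnion fun w => insert w (U.filter fun u => H.Adj w u) := by
    intro u hu
    simp only [Finset.mem_biUnion, Finset.mem_insert, Finset.mem_filter]
    by_contra hcon
    push Not at hcon
    have huW : u ∉ W := fun h => (hcon u h).1 rfl
    have := hmax (insert u W) ⟨Finset.insert_subset hu hW.1, by
      rw [Finset.coe_insert]
      intro a ha b hb hab
      rcases ha with rfl | ha <;> rcases hb with rfl | hb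
      · exact absurd rfl hab
      · exact fun h => (hcon b hb).2 hu h.symm
      · exact fun h => (hcon a ha).2 hu h
      · exact hW.2 ha hb hab⟩
    rw [Finset.card_insert_of_notMem huW] at this
    omega
  refine (Finset.card_le_card hsub).trans ?_
  refine (Finset.card_biUnion_le_card_mul _ _ (Δ + 1) fun w hw => ?_).trans ?_
  · exact (Finset.card_insert_le _ _).trans (Nat.add_le_add_right (hdeg w (hW.1 hw)) 1)
  · exact Nat.mul_le_mul_right _ (hind W hW.1 hW.2).le

/-- The polynomial Erdős–Szekeres type bound. -/
theorem IsRamseyConfig.card_le_pow [Fintype ι] (S : ℕ) :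
    ∀ (s : ι → ℕ) (U : Finset V), IsRamseyConfig G s t U → (∀ i, 2 ≤ s i) →
      ∑ i, (s i - 2) = S → U.card ≤ (Fintype.card ι + 1) ^ S * t ^ (S + 1) := by
  classical
  induction S with
  | zero =>
    intro s U h hs hS
    have hs2 : ∀ i, s i = 2 := by
      intro i
      have := (Finset.sum_eq_zero_iff.1 hS) i (Finset.mem_univ i)
      have := hs i
      omega
    have : U.card < t := by
      refine h.card_lt U subset_rfl fun v hv w hw _ hvw => ?_
      obtain ⟨i, hi⟩ := SimpleGraph.iSup_adj.1 hvw
      have h2 := h.cliqueFreeOn i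
      rw [hs2 i] at h2
      exact h2.not_adj hv hw hi
    simpa using this.le
  | succ S ih =>
    intro s U h hs hS
    have ht := h.pos
    have hB : 1 ≤ (Fintype.card ι + 1) ^ S * t ^ (S + 1) := Nat.succ_le_of_lt (by positivity)
    have := card_le_mul_of_degree_le (⨆ i, G i) U (t := t) (fun v hv =>
      h.degree_le hs (B := (Fintype.card ι + 1) ^ S * t ^ (S + 1)) (fun i hi U' _ hc => by
        refine ih _ U' hc (two_le_update hs (by omega)) ?_
        have := sum_update_sub_two hi
        omega) hv) h.card_lt
    refine this.trans ?_
    calc t * (Fintype.card ι * ((Fintype.card ι + 1) ^ S * t ^ (S + 1)) + 1)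
        ≤ t * (Fintype.card ι * ((Fintype.card ι + 1) ^ S * t ^ (S + 1)) +
            (Fintype.card ι + 1) ^ S * t ^ (S + 1)) := by gcongr
      _ = _ := by ring

-- In the two admitted color patterns the common neighborhood loses two from `∑ (s i - 2)`, or is
-- empty: distinct `j` and `l` lower two different bounds, while a monochromatic triangle lowers the
-- same bound twice, the second time because `u` itself lies in the color-`i` neighborhood of `v`.
-- The polynomial bound then applies.
open Classical in
theorem IsRamseyConfig.codegree_le [Fintype ι] {S : ℕ} (h : IsRamseyConfig G s t U)
    (hs : ∀ i, 2 ≤ s i) (hS : ∑ i, (s i - 2) = S + 1) {u v : V} (hu : u ∈ U) (hv : v ∈ U)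
    {i j l : ι} (hvu : (G i).Adj v u) (hij : j ≠ l ∨ (i = j ∧ j = l)) :
    (U.filter fun w => (G j).Adj v w ∧ (G l).Adj u w).card ≤
      (Fintype.card ι + 1) ^ (S + 1) * t ^ S := by
  set U' := U.filter fun w => (G j).Adj v w ∧ (G l).Adj u w with hU'
  have hsub : U' ⊆ U := Finset.filter_subset _ _
  have ht := h.pos
  have key : ∀ s' : ι → ℕ, IsRamseyConfig G s' t U' → (∀ i, 2 ≤ s' i) →
      ∑ i, (s' i - 2) + 2 = S + 1 → U'.card ≤ (Fintype.card ι + 1) ^ (S + 1) * t ^ S := by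
    intro s' hc hs' hsum
    refine (hc.card_le_pow _ s' U' hs' rfl).trans ?_
    have : ∑ i, (s' i - 2) + 1 = S := by omega
    rw [this]
    gcongr
    · omega
    · omega
  have hempty : U' = ∅ → U'.card ≤ (Fintype.card ι + 1) ^ (S + 1) * t ^ S := by
    intro h
    simp [h]
  rcases hij with hjl | ⟨rfl, rfl⟩
  · rcases (hs j).eq_or_lt with hj | hj
    · apply hempty
      have h2 := h.cliqueFreeOn j
      rw [← hj] at h2
      exact Finset.filter_eq_empty_iff.2 fun w hw hadj => h2.not_adj hv hw hadj.1
    rcases (hs l).eq_or_lt with hl | hl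
    · apply hempty
      have h2 := h.cliqueFreeOn l
      rw [← hl] at h2
      exact Finset.filter_eq_empty_iff.2 fun w hw hadj => h2.not_adj hu hw hadj.2
    refine key _ (h.pred_pred hu hv hsub (fun w hw => (Finset.mem_filter.1 hw).2.1)
      fun w hw => (Finset.mem_filter.1 hw).2.2)
      (two_le_update (two_le_update hs (by omega)) (by omega)) ?_
    have h1 := sum_update_sub_two (s := s) (i := j) hj
    have h2 := sum_update_sub_two (s := Function.update s j (s j - 1)) (i := l)
      (by rw [Function.update_of_ne hjl.symm]; exact hl)
    rw [Function.update_of_ne hjl.symm] at h2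
    omega
  · rcases (hs i).eq_or_lt with hi | hi
    · have h2 := h.cliqueFreeOn i
      rw [← hi] at h2
      exact absurd hvu (h2.not_adj hv hu)
    have hc1 := h.pred (U' := U.filter fun w => (G i).Adj v w) hv (Finset.filter_subset _ _)
      fun w hw => (Finset.mem_filter.1 hw).2
    have hc2 := hc1.pred (U' := U') (v := u) (i := i) (Finset.mem_filter.2 ⟨hu, hvu⟩)
      (fun w hw => Finset.mem_filter.2 ⟨hsub hw, (Finset.mem_filter.1 hw).2.1⟩)
      (fun w hw => (Finset.mem_filter.1 hw).2.2)
    rw [Function.update_idem, Function.update_self] at hc2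
    rcases (show 3 ≤ s i from hi).eq_or_lt with hi3 | hi3
    · apply hempty
      have h1 := hc2.cliqueFreeOn i
      rw [Function.update_self, ← hi3] at h1
      exact h1.eq_empty
    · refine key _ hc2 (two_le_update hs (by omega)) ?_
      have h1 := sum_update_sub_two (s := s) (i := i) hi
      have h2 := sum_update_sub_two (s := Function.update s i (s i - 1)) (i := i)
        (by rw [Function.update_self]; omega)
      rw [Function.update_self, Function.update_idem] at h2
      omega

theorem card_filter_product_le (U A : Finset V) (R : V → V → Prop) [DecidableRel R] {D : ℕ}
    (hA : ∀ u ∈ U, ∀ w ∈ U, R u w → u ∈ A)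
    (hD : ∀ u ∈ U, u ∈ A → (U.filter fun w => R u w).card ≤ D) :
    ((U ×ˢ U).filter fun p => R p.1 p.2).card ≤ A.card * D := by
  classical
  rw [mul_comm]
  refine Finset.card_le_mul_card_image_of_maps_to (f := Prod.fst) (fun p hp => ?_) D fun u hu => ?_
  · simp only [Finset.mem_filter, Finset.mem_product] at hp
    exact hA _ hp.1.1 _ hp.1.2 hp.2
  · by_cases huU : u ∈ U
    · refine le_trans ?_ (hD u huU hu)
      refine Finset.card_le_card_of_injOn Prod.snd ?_ ?_
      · rintro ⟨a, b⟩ hp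
        simp only [Finset.coe_filter, Finset.mem_filter, Finset.mem_product, Set.mem_ofPred_eq] at hp ⊢
        obtain ⟨⟨⟨_, h1⟩, h2⟩, rfl⟩ := hp
        exact ⟨h1, h2⟩
      · rintro ⟨a, b⟩ hp ⟨a', b'⟩ hp' hbb
        simp only [Finset.coe_filter, Finset.mem_filter, Finset.mem_product, Set.mem_ofPred_eq]
          at hp hp' hbb
        rw [hp.2, hp'.2, hbb]
    · rw [Finset.card_eq_zero.2]
      · exact Nat.zero_le _
      · ext ⟨a, b⟩
        simp only [Finset.mem_filter, Finset.mem_product, Finset.notMem_empty, iff_false]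
        rintro ⟨⟨⟨h1, _⟩, _⟩, rfl⟩
        exact huU h1

theorem card_filter_product_le' (U A : Finset V) (R : V → V → Prop) [DecidableRel R] {D : ℕ}
    (hA : ∀ u ∈ U, ∀ w ∈ U, R u w → w ∈ A)
    (hD : ∀ w ∈ U, w ∈ A → (U.filter fun u => R u w).card ≤ D) :
    ((U ×ˢ U).filter fun p => R p.1 p.2).card ≤ A.card * D := by
  refine le_trans ?_ (card_filter_product_le U A (fun w u => R u w)
    (fun w hw u hu h => hA u hu w hw h) hD)
  refine Finset.card_le_card_of_injOn Prod.swap ?_ Prod.swap_injective.injOn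
  rintro ⟨a, b⟩ hp
  simp only [Finset.coe_filter, Finset.mem_product, Set.mem_ofPred_eq, Prod.swap] at hp ⊢
  tauto

-- For each of the `k ^ 3` color patterns, one of the two other vertices of the triangle ranges over
-- the neighbors of `v`, and the last vertex is counted by a codegree. Which of the two is fixed
-- first depends on the pattern.
open Classical in
theorem IsRamseyConfig.triangles_le [Fintype ι] {S Δ : ℕ} (h : IsRamseyConfig G s t U)
    (hs : ∀ i, 2 ≤ s i) (hS : ∑ i, (s i - 2) = S + 1) {v : V} (hv : v ∈ U)
    (hΔ : (U.filter fun u => (⨆ i, G i).Adj v u).card ≤ Δ) :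
    ((U ×ˢ U).filter fun p => (⨆ i, G i).Adj v p.1 ∧ (⨆ i, G i).Adj v p.2 ∧
      (⨆ i, G i).Adj p.1 p.2).card ≤
      Fintype.card ι ^ 3 * (Δ * ((Fintype.card ι + 1) ^ (S + 1) * t ^ S)) := by
  set D := (Fintype.card ι + 1) ^ (S + 1) * t ^ S with hD
  set A := U.filter fun u => (⨆ i, G i).Adj v u with hA
  have hsub : ((U ×ˢ U).filter fun p => (⨆ i, G i).Adj v p.1 ∧ (⨆ i, G i).Adj v p.2 ∧
      (⨆ i, G i).Adj p.1 p.2) ⊆ (Finset.univ : Finset (ι × ι × ι)).biUnion fun c =>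
        (U ×ˢ U).filter fun p => (G c.1).Adj v p.1 ∧ (G c.2.1).Adj v p.2 ∧
          (G c.2.2).Adj p.1 p.2 := by
    rintro p hp
    simp only [Finset.mem_filter, SimpleGraph.iSup_adj] at hp
    obtain ⟨hp, ⟨i, hi⟩, ⟨j, hj⟩, ⟨l, hl⟩⟩ := hp
    simp only [Finset.mem_biUnion, Finset.mem_univ, true_and, Finset.mem_filter]
    exact ⟨(i, j, l), hp, hi, hj, hl⟩
  refine (Finset.card_le_card hsub).trans ?_
  refine (Finset.card_biUnion_le_card_mul _ _ (Δ * D) ?_).trans ?_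
  swap
  · simp only [Finset.card_univ, Fintype.card_prod]
    exact le_of_eq (by ring)
  rintro ⟨i, j, l⟩ -
  dsimp only
  refine le_trans ?_ (Nat.mul_le_mul_right D hΔ)
  have hmem : ∀ {i u}, u ∈ U → (G i).Adj v u → u ∈ A := fun {i u} hu hvu =>
    Finset.mem_filter.2 ⟨hu, SimpleGraph.iSup_adj.2 ⟨i, hvu⟩⟩
  by_cases hc : j ≠ l ∨ (i = j ∧ j = l)
  · refine card_filter_product_le (D := D) U A
      (fun u w => (G i).Adj v u ∧ (G j).Adj v w ∧ (G l).Adj u w)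
      (fun u hu w _ hR => hmem hu hR.1) fun u hu _ => ?_
    by_cases hvu : (G i).Adj v u
    · simpa only [hvu, true_and] using h.codegree_le hs hS hu hv hvu hc
    · simp [hvu]
  -- The remaining pattern is `j = l ≠ i`. Fixing `w` instead of `u` makes the edges from `v` and
  -- `w` to the last vertex differently colored, so the codegree bound applies again.
  · have hil : i ≠ l := by
      rintro rfl
      by_cases hji : j = i
      · exact hc (Or.inr ⟨hji.symm, hji⟩)
      · exact hc (Or.inl hji)
    refine card_filter_product_le' (D := D) U A
      (fun u w => (G i).Adj v u ∧ (G j).Adj v w ∧ (G l).Adj u w)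
      (fun u _ w hw hR => hmem hw hR.2.1) fun w hw _ => ?_
    by_cases hvw : (G j).Adj v w
    · have := h.codegree_le hs hS hw hv hvw (j := i) (l := l) (Or.inl hil)
      simpa only [hvw, true_and, (G l).adj_comm w] using this
    · simp [hvw]

end Config

/-! ### The upper bound -/

/-- From `log x ≤ x ^ ε / ε` with `ε = 1 / (2 * (S + 1))`, since `S * ε ≤ 1 / 2`. -/
theorem log_pow_le_mul_sqrt (S : ℕ) :
    ∃ M : ℝ, 1 ≤ M ∧ ∀ x : ℝ, 1 ≤ x → Real.log x ^ S ≤ M * Real.sqrt x := by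
  have hS : (0 : ℝ) < 2 * (S + 1) := by positivity
  refine ⟨(2 * (S + 1)) ^ S, one_le_pow₀ (by norm_cast; omega), fun x hx => ?_⟩
  have h0 : (0 : ℝ) ≤ x := by linarith
  have h1 := Real.log_le_rpow_div h0 (ε := 1 / (2 * (S + 1))) (by positivity)
  calc Real.log x ^ S ≤ (x ^ (1 / (2 * (S + 1) : ℝ)) / (1 / (2 * (S + 1)))) ^ S :=
        pow_le_pow_left₀ (Real.log_nonneg hx) h1 S
    _ = (2 * (S + 1)) ^ S * x ^ ((S : ℝ) / (2 * (S + 1))) := by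
        rw [div_div_eq_mul_div, div_one, mul_pow, ← Real.rpow_mul_natCast h0, mul_comm]
        congr 2
        field_simp
    _ ≤ (2 * (S + 1)) ^ S * Real.sqrt x := by
        rw [Real.sqrt_eq_rpow]
        refine mul_le_mul_of_nonneg_left (Real.rpow_le_rpow_of_exponent_le hx ?_) (by positivity)
        rw [div_le_div_iff₀ hS (by norm_num)]
        linarith

/-- The upper bound for the Ramsey problem, in terms of configurations. -/
theorem IsRamseyConfig.exists_card_le {ι : Type*} [Fintype ι] (S : ℕ) :
    ∀ s : ι → ℕ, (∀ i, 2 ≤ s i) → ∑ i, (s i - 2) = S →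
      ∃ C : ℝ, 0 < C ∧ ∀ t : ℕ, 2 ≤ t → ∀ (N : ℕ) (G : ι → SimpleGraph (Fin N))
        (U : Finset (Fin N)), IsRamseyConfig G s t U →
          (U.card : ℝ) ≤ C * ((t : ℝ) ^ (S + 1) / Real.log t ^ S) := by
  classical
  induction S with
  | zero =>
    intro s hs hS
    refine ⟨1, one_pos, fun t ht N G U h => ?_⟩
    have := h.card_le_pow 0 s U hs hS
    simp only [pow_zero, zero_add, pow_one, one_mul] at this
    simpa using this
  | succ S ih =>
    intro s hs hS
    -- A color that cannot be lowered gets the dummy constant `1`, so that constants can be chosen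
    -- for all colors at once.
    have hih : ∀ i, ∃ C : ℝ, 0 < C ∧ (3 ≤ s i → ∀ t : ℕ, 2 ≤ t → ∀ (N : ℕ)
        (G : ι → SimpleGraph (Fin N)) (U : Finset (Fin N)),
        IsRamseyConfig G (Function.update s i (s i - 1)) t U →
          (U.card : ℝ) ≤ C * ((t : ℝ) ^ (S + 1) / Real.log t ^ S)) := by
      intro i
      by_cases hi : 3 ≤ s i
      · obtain ⟨C, hC, h⟩ := ih (Function.update s i (s i - 1))
          (two_le_update hs (by omega)) (by have := sum_update_sub_two hi; omega)
        exact ⟨C, hC, fun _ => h⟩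
      · exact ⟨1, one_pos, fun h => absurd h hi⟩
    choose C hC0 hC using hih
    obtain ⟨M, hM1, hM⟩ := log_pow_le_mul_sqrt S
    set k := Fintype.card ι with hk
    have hk1 : 1 ≤ k := by
      by_contra hcon
      have : IsEmpty ι := Fintype.card_eq_zero_iff.1 (by omega)
      simp at hS
    set C₀ : ℝ := ∑ i, C i with hC₀
    have hC₀0 : 0 ≤ C₀ := Finset.sum_nonneg fun i _ => (hC0 i).le
    have hCle : ∀ i, C i ≤ C₀ := fun i =>
      Finset.single_le_sum (fun i _ => (hC0 i).le) (Finset.mem_univ i)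
    set K₂ : ℝ := (k : ℝ) ^ 3 * ((k : ℝ) + 1) ^ (S + 1) with hK₂
    have hk1' : (1 : ℝ) ≤ k := by exact_mod_cast hk1
    have hK₂1 : 1 ≤ K₂ := one_le_mul_of_one_le_of_one_le (one_le_pow₀ hk1')
      (one_le_pow₀ (by linarith))
    -- The first summand covers the degrees; the second forces `Δ / D ≥ √t` for `Δ = K * X` and `D =
    -- K₂ * t ^ S`.
    set K : ℝ := k * C₀ + K₂ * M with hK
    have hK0 : 0 < K := by positivity
    refine ⟨512 * K, by positivity, fun t ht N G U h => ?_⟩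
    have ht1 : (1 : ℝ) < t := by exact_mod_cast ht
    have hlog : 0 < Real.log t := Real.log_pos ht1
    set X : ℝ := (t : ℝ) ^ (S + 1) / Real.log t ^ S with hX
    have hX0 : 0 < X := by positivity
    have hdegN : ∀ v ∈ U, (U.filter fun u => (⨆ i, G i).Adj v u).card ≤ k * ⌊C₀ * X⌋₊ := by
      intro v hv
      refine h.degree_le hs (fun i hi U' _ hc => Nat.le_floor ?_) hv
      refine (hC i hi t ht N G U' hc).trans ?_
      gcongr
      exact hCle i
    have hΔN : ((k * ⌊C₀ * X⌋₊ : ℕ) : ℝ) ≤ K * X := by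
      push_cast
      have := Nat.floor_le (show 0 ≤ C₀ * X by positivity)
      calc (k : ℝ) * ⌊C₀ * X⌋₊ ≤ k * (C₀ * X) := by gcongr
        _ ≤ K * X := by
          have : 0 ≤ K₂ * M * X := by positivity
          rw [hK]
          linarith
    have hD1 : 1 ≤ K₂ * (t : ℝ) ^ S :=
      one_le_mul_of_one_le_of_one_le hK₂1 (one_le_pow₀ ht1.le)
    have hratio : Real.sqrt t ≤ K * X / (K₂ * (t : ℝ) ^ S) := by
      rw [le_div_iff₀ (by linarith), hX, mul_div_assoc', le_div_iff₀ (by positivity)]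
      have h1 := hM t ht1.le
      have h2 := Real.mul_self_sqrt (show (0 : ℝ) ≤ t by linarith)
      calc Real.sqrt t * (K₂ * (t : ℝ) ^ S) * Real.log t ^ S
          ≤ Real.sqrt t * (K₂ * (t : ℝ) ^ S) * (M * Real.sqrt t) := by gcongr
        _ = K₂ * M * (t : ℝ) ^ S * (Real.sqrt t * Real.sqrt t) := by ring
        _ = K₂ * M * (t : ℝ) ^ (S + 1) := by rw [h2]; ring
        _ ≤ K * (t : ℝ) ^ (S + 1) := by
            gcongr
            have : 0 ≤ k * C₀ := by positivity
            linarith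
    have hsqrt1 : 1 ≤ Real.sqrt t := Real.one_le_sqrt.2 ht1.le
    have hDΔ : K₂ * (t : ℝ) ^ S ≤ K * X := by
      have := hsqrt1.trans hratio
      rwa [one_le_div (by linarith)] at this
    obtain ⟨W, hWU, hWi, hWc⟩ := exists_indepSet_of_few_triangles (⨆ i, G i) U hD1 hDΔ
      (fun v hv => le_trans (Nat.cast_le.2 (hdegN v hv)) hΔN) (fun v hv => by
        refine le_trans (Nat.cast_le.2 (h.triangles_le hs hS hv (hdegN v hv))) ?_
        rw [Nat.cast_mul, Nat.cast_mul, ← hk]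
        calc ((k ^ 3 : ℕ) : ℝ) * (((k * ⌊C₀ * X⌋₊ : ℕ) : ℝ) * (((k + 1) ^ (S + 1) * t ^ S : ℕ) : ℝ))
            ≤ ((k ^ 3 : ℕ) : ℝ) * ((K * X) * (((k + 1) ^ (S + 1) * t ^ S : ℕ) : ℝ)) := by gcongr
          _ = _ := by push_cast; ring)
    have hWt : (W.card : ℝ) ≤ t := Nat.cast_le.2 (h.card_lt W hWU hWi).le
    have hl : Real.log t / 2 ≤ Real.log (K * X / (K₂ * (t : ℝ) ^ S)) := by
      rw [← Real.log_sqrt (by linarith)]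
      exact Real.log_le_log (by linarith) hratio
    have h1 : (U.card : ℝ) * (Real.log t / 2 / (256 * (K * X))) ≤ t := by
      refine le_trans ?_ (hWc.trans hWt)
      gcongr
    rw [mul_div_assoc', div_le_iff₀ (by positivity)] at h1
    have h2 : (t : ℝ) ^ (S + 1 + 1) / Real.log t ^ (S + 1) = t * X / Real.log t := by
      rw [hX, pow_succ (t : ℝ) (S + 1), pow_succ (Real.log t)]
      field_simp
    rw [h2, mul_div_assoc', le_div_iff₀ hlog]
    linarith

theorem isRamseyConfig_labelGraph {k N t : ℕ} {s : Fin k → ℕ}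
    (c : SimpleGraph.TopEdgeLabeling (Fin N) (Fin (k + 1)))
    (hc : ∀ i, (c.labelGraph i).CliqueFree ((Fin.snoc s t : Fin (k + 1) → ℕ) i)) :
    IsRamseyConfig (fun i : Fin k => c.labelGraph i.castSucc) s t Finset.univ := by
  refine ⟨fun i => ?_, fun W _ hW => ?_⟩
  · have := hc i.castSucc
    rw [Fin.snoc_castSucc] at this
    exact this.cliqueFreeOn
  · by_contra hcon
    have hlast := hc (Fin.last k)
    rw [Fin.snoc_last] at hlast
    refine hlast.mono (not_lt.1 hcon) W ⟨fun a ha b hb hab => ?_, rfl⟩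
    rw [SimpleGraph.TopEdgeLabeling.labelGraph_adj]
    refine ⟨hab, ?_⟩
    by_contra hne
    refine hW ha hb hab (SimpleGraph.iSup_adj.2 ?_)
    obtain ⟨i, hi⟩ := Fin.exists_castSucc_eq.2 hne
    exact ⟨i, (SimpleGraph.TopEdgeLabeling.labelGraph_adj a b).2 ⟨hab, hi.symm⟩⟩

/-- The Ramsey number is attained, and it obeys the upper bound. -/
theorem exists_ramseyNumber_le {k S : ℕ} (s : Fin k → ℕ) (hs : ∀ i, 2 ≤ s i)
    (hS : ∑ i, (s i - 2) = S) :
    ∃ C : ℝ, 0 < C ∧ ∀ t : ℕ, 2 ≤ t →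
      (∃ N : ℕ, 0 < N ∧ ∀ c : SimpleGraph.TopEdgeLabeling (Fin N) (Fin (k + 1)),
        ∃ i, ¬ (c.labelGraph i).CliqueFree ((Fin.snoc s t : Fin (k + 1) → ℕ) i)) ∧
      (ramseyNumber (Fin.snoc s t : Fin (k + 1) → ℕ) : ℝ) ≤
        C * ((t : ℝ) ^ (S + 1) / Real.log t ^ S) := by
  obtain ⟨C, hC, h⟩ := IsRamseyConfig.exists_card_le S s hs hS
  -- The extra `1` absorbs the rounding of `C * X` to an integer, as `X ≥ 1`.
  refine ⟨C + 1, by linarith, fun t ht => ?_⟩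
  have ht1 : (1 : ℝ) < t := by exact_mod_cast ht
  have hlog : 0 < Real.log t := Real.log_pos ht1
  set X : ℝ := (t : ℝ) ^ (S + 1) / Real.log t ^ S with hX
  have hX1 : 1 ≤ X := by
    rw [hX, le_div_iff₀ (by positivity), one_mul]
    have h1 : Real.log t ≤ t := (Real.log_le_sub_one_of_pos (by linarith)).trans (by linarith)
    calc Real.log t ^ S ≤ (t : ℝ) ^ S := pow_le_pow_left₀ hlog.le h1 S
      _ ≤ (t : ℝ) ^ (S + 1) := pow_le_pow_right₀ ht1.le (Nat.le_succ S)
  have hmem : ∀ c : SimpleGraph.TopEdgeLabeling (Fin (⌊C * X⌋₊ + 1)) (Fin (k + 1)),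
      ∃ i, ¬ (c.labelGraph i).CliqueFree ((Fin.snoc s t : Fin (k + 1) → ℕ) i) := by
    intro c
    by_contra hcon
    push Not at hcon
    have h1 := h t ht _ _ _ (isRamseyConfig_labelGraph c hcon)
    rw [Finset.card_univ, Fintype.card_fin] at h1
    have h2 := Nat.lt_floor_add_one (C * X)
    push_cast at h1
    linarith
  refine ⟨⟨_, Nat.succ_pos _, hmem⟩, ?_⟩
  have hle : ramseyNumber (Fin.snoc s t : Fin (k + 1) → ℕ) ≤ ⌊C * X⌋₊ + 1 :=
    Nat.sInf_le ⟨Nat.succ_pos _, hmem⟩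
  calc (ramseyNumber (Fin.snoc s t : Fin (k + 1) → ℕ) : ℝ) ≤ ((⌊C * X⌋₊ + 1 : ℕ) : ℝ) :=
        Nat.cast_le.2 hle
    _ ≤ C * X + 1 := by
        push_cast
        linarith [Nat.floor_le (show 0 ≤ C * X by positivity)]
    _ ≤ (C + 1) * X := by linarith

/-! ### Spectral bounds and the expander mixing lemma -/

/-- A real symmetric matrix all of whose eigenvalues are bounded by `Λ` has operator norm at
most `Λ`. -/
theorem Matrix.IsHermitian.abs_dotProduct_mulVec_le {n : Type*} [Fintype n] [DecidableEq n]
    {M : Matrix n n ℝ} (hM : M.IsHermitian) {Λ : ℝ} (hΛ : 0 ≤ Λ)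
    (h : ∀ (μ : ℝ) (v : n → ℝ), v ≠ 0 → M *ᵥ v = μ • v → |μ| ≤ Λ) (x y : n → ℝ) :
    |x ⬝ᵥ M *ᵥ y| ≤ Λ * (Real.sqrt (x ⬝ᵥ x) * Real.sqrt (y ⬝ᵥ y)) := by
  set T := Matrix.toEuclideanLin M with hT
  have hTs : T.IsSymmetric := Matrix.isSymmetric_toEuclideanLin_iff.2 hM
  have hTapp : ∀ z : EuclideanSpace ℝ n, (T z).ofLp = M *ᵥ z.ofLp := fun z => by
    simp [hT]
  set b := hTs.eigenvectorBasis rfl with hb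
  have hev : ∀ i, |hTs.eigenvalues rfl i| ≤ Λ := by
    intro i
    have h1 := hTs.apply_eigenvectorBasis rfl i
    refine h _ (b i).ofLp ?_ ?_
    · intro h0
      have : b i = 0 := by ext j; exact congrFun h0 j
      have h2 := b.orthonormal.1 i
      rw [this] at h2
      simp at h2
    · rw [← hTapp, h1]
      rfl
  have hnorm : ∀ z : EuclideanSpace ℝ n, ‖T z‖ ≤ Λ * ‖z‖ := by
    intro z
    rw [← sq_le_sq₀ (norm_nonneg _) (by positivity), ← b.repr.norm_map (T z), mul_pow,
      ← b.repr.norm_map z, EuclideanSpace.norm_sq_eq, EuclideanSpace.norm_sq_eq, Finset.mul_sum]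
    refine Finset.sum_le_sum fun i _ => ?_
    rw [hTs.eigenvectorBasis_apply_self_apply rfl z i, norm_mul, mul_pow]
    gcongr
    simpa using hev i
  have h1 : x ⬝ᵥ M *ᵥ y = inner ℝ (WithLp.toLp 2 x) (T (WithLp.toLp 2 y)) := by
    rw [EuclideanSpace.inner_eq_star_dotProduct, hTapp, dotProduct_comm]
    simp
  have h2 : ∀ z : n → ℝ, Real.sqrt (z ⬝ᵥ z) = ‖WithLp.toLp 2 z‖ := by
    intro z
    rw [EuclideanSpace.norm_eq]
    congr 1
    simp [dotProduct, sq]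
  rw [h1, h2, h2]
  calc |inner ℝ (WithLp.toLp 2 x) (T (WithLp.toLp 2 y))|
      ≤ ‖WithLp.toLp 2 x‖ * ‖T (WithLp.toLp 2 y)‖ := abs_real_inner_le_norm _ _
    _ ≤ ‖WithLp.toLp 2 x‖ * (Λ * ‖WithLp.toLp 2 y‖) := by
        gcongr
        exact hnorm _
    _ = _ := by ring

/-- The expander mixing lemma. -/
theorem IsNDLambdaGraph.expander_mixing {n : ℕ} {G : SimpleGraph (Fin n)} [DecidableRel G.Adj]
    {d : ℕ} {lam : ℝ} (h : IsNDLambdaGraph G d lam) (A B : Finset (Fin n)) :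
    |(∑ x ∈ A, ((B.filter fun y => G.Adj x y).card : ℝ)) - d * A.card * B.card / n| ≤
      |lam| * (Real.sqrt A.card * Real.sqrt B.card) := by
  rcases Nat.eq_zero_or_pos n with rfl | hn
  · have hA : A = ∅ := Finset.eq_empty_of_isEmpty A
    simp [hA]
  have hn0 : (n : ℝ) ≠ 0 := by positivity
  set M : Matrix (Fin n) (Fin n) ℝ := G.adjMatrix ℝ - Matrix.of fun _ _ => (d : ℝ) / n with hM
  have hMv : ∀ (v : Fin n → ℝ) (i : Fin n),
      (M *ᵥ v) i = (G.adjMatrix ℝ *ᵥ v) i - d / n * ∑ x, v x := by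
    intro v i
    rw [hM, Matrix.sub_mulVec, Pi.sub_apply]
    congr 1
    simp only [Matrix.mulVec, dotProduct, Matrix.of_apply, Finset.mul_sum]
  have hMs : M.IsHermitian := by
    ext i j
    simp [hM, Matrix.conjTranspose_apply, SimpleGraph.adjMatrix_apply, G.adj_comm]
  have hcol : ∀ v : Fin n → ℝ, ∑ i, (G.adjMatrix ℝ *ᵥ v) i = d * ∑ x, v x := by
    intro v
    have h1 : ∑ i, (G.adjMatrix ℝ *ᵥ v) i = (fun _ => (1 : ℝ)) ⬝ᵥ (G.adjMatrix ℝ *ᵥ v) := by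
      simp [dotProduct]
    rw [h1, Matrix.dotProduct_mulVec, ← Matrix.mulVec_transpose, SimpleGraph.transpose_adjMatrix]
    simp only [dotProduct, SimpleGraph.adjMatrix_mulVec_apply, Finset.sum_const,
      SimpleGraph.card_neighborFinset_eq_degree, h.regular.degree_eq, nsmul_eq_mul, mul_one,
      Finset.mul_sum]
  have hsum0 : ∀ v : Fin n → ℝ, ∑ i, (M *ᵥ v) i = 0 := by
    intro v
    simp only [hMv, Finset.sum_sub_distrib, hcol, Finset.sum_const, Finset.card_univ,
      Fintype.card_fin, nsmul_eq_mul]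
    field_simp
    ring
  -- The columns of `M` sum to `0`, so an eigenvector with `μ ≠ 0` has coordinate sum `0`; on it `M`
  -- agrees with the adjacency matrix.
  have hev : ∀ (μ : ℝ) (v : Fin n → ℝ), v ≠ 0 → M *ᵥ v = μ • v → |μ| ≤ |lam| := by
    intro μ v hv hμ
    rcases eq_or_ne μ 0 with rfl | hμ0
    · simp
    have hv0 : ∑ x, v x = 0 := by
      have := hsum0 v
      rw [hμ] at this
      simp only [Pi.smul_apply, smul_eq_mul, ← Finset.mul_sum] at this
      exact (mul_eq_zero.1 this).resolve_left hμ0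
    refine (h.spectral μ v hv hv0 ?_).trans (le_abs_self lam)
    ext i
    have := congrFun hμ i
    rw [hMv, hv0] at this
    simpa using this
  have key := hMs.abs_dotProduct_mulVec_le (abs_nonneg lam) hev
    (fun i => if i ∈ A then (1 : ℝ) else 0) (fun i => if i ∈ B then (1 : ℝ) else 0)
  have hind : ∀ A : Finset (Fin n), (fun i => if i ∈ A then (1 : ℝ) else 0) ⬝ᵥ
      (fun i => if i ∈ A then (1 : ℝ) else 0) = A.card := by
    intro A
    simp [dotProduct]
  rw [hind, hind] at key
  convert key using 2
  simp only [dotProduct, hMv, SimpleGraph.adjMatrix_mulVec_apply, ite_mul, one_mul, zero_mul,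
    Finset.sum_ite_mem, Finset.univ_inter, Finset.sum_sub_distrib, Finset.sum_const, nsmul_eq_mul,
    mul_one]
  congr 1
  · refine Finset.sum_congr rfl fun x _ => ?_
    congr 2
    ext y
    simp [and_comm]
  · ring

/-! ### Counting sequences of pairwise nonadjacent vertices -/

open Classical in
/-- Sequences of `t` vertices in `A`, pairwise nonadjacent, repetitions allowed. -/
noncomputable def nonadjSeq {V : Type*} [Fintype V] (G : SimpleGraph V) (t : ℕ) (A : Finset V) :
    Finset (Fin t → V) :=
  {x | (∀ i, x i ∈ A) ∧ ∀ i j, ¬ G.Adj (x i) (x j)}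

-- The first entry `v` confines the others to the non-neighbors of `v` in `A`, among which `v`
-- itself remains.
open Classical in
theorem card_nonadjSeq_succ_le {V : Type*} [Fintype V] (G : SimpleGraph V) (t : ℕ)
    (A : Finset V) : (nonadjSeq G (t + 1) A).card ≤
      ∑ v ∈ A, (nonadjSeq G t (A.filter fun u => ¬ G.Adj v u)).card := by
  rw [← Finset.card_sigma]
  refine Finset.card_le_card_of_injOn (fun x => ⟨x 0, Fin.tail x⟩) ?_ ?_
  · intro x hx
    simp only [nonadjSeq, Finset.coe_filter, Finset.mem_univ, true_and, Set.mem_ofPred_eq] at hx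
    simp only [nonadjSeq, Finset.coe_sigma, Set.mem_sigma_iff, Finset.mem_coe, Finset.mem_filter,
      Finset.mem_univ, true_and]
    exact ⟨hx.1 0, fun i => ⟨hx.1 _, hx.2 _ _⟩, fun i j => hx.2 _ _⟩
  · intro x _ y _ hxy
    simp only [Sigma.mk.injEq, heq_eq_eq] at hxy
    rw [← Fin.cons_self_tail x, ← Fin.cons_self_tail y, hxy.1, hxy.2]

theorem nonadjSeq_mono {V : Type*} [Fintype V] (G : SimpleGraph V) (t : ℕ) {A B : Finset V}
    (h : A ⊆ B) : nonadjSeq G t A ⊆ nonadjSeq G t B := by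
  intro x hx
  simp only [nonadjSeq, Finset.mem_filter, Finset.mem_univ, true_and] at hx ⊢
  exact ⟨fun i => h (hx.1 i), hx.2⟩

open Classical in
/-- The number of vertices of `A` with few neighbors in `A` is bounded. -/
theorem IsNDLambdaGraph.card_low_degree_le {n : ℕ} {G : SimpleGraph (Fin n)}
    {d : ℕ} {lam : ℝ} (h : IsNDLambdaGraph G d lam) (hn : 0 < n) (hd : 0 < d)
    (A : Finset (Fin n)) :
    ((A.filter fun x => ((A.filter fun y => G.Adj x y).card : ℝ) <
      d / (2 * n) * A.card).card : ℝ) ≤ 2 * |lam| * n / d := by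
  set B := A.filter fun x => ((A.filter fun y => G.Adj x y).card : ℝ) < d / (2 * n) * A.card
    with hB
  have hn0 : (0 : ℝ) < n := Nat.cast_pos.2 hn
  have hd0 : (0 : ℝ) < d := Nat.cast_pos.2 hd
  have hmix := (abs_le.1 (h.expander_mixing B A)).1
  have hle : ∑ x ∈ B, ((A.filter fun y => G.Adj x y).card : ℝ) ≤
      B.card * (d / (2 * n) * A.card) := by
    rw [← nsmul_eq_mul, ← Finset.sum_const]
    exact Finset.sum_le_sum fun x hx => (Finset.mem_filter.1 hx).2.le
  have hBA : (B.card : ℝ) ≤ A.card := Nat.cast_le.2 (Finset.card_le_card (Finset.filter_subset _ _))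
  set a := Real.sqrt A.card with ha
  set b := Real.sqrt B.card with hb
  have ha2 : a * a = A.card := Real.mul_self_sqrt (Nat.cast_nonneg _)
  have hb2 : b * b = B.card := Real.mul_self_sqrt (Nat.cast_nonneg _)
  have hba : b ≤ a := Real.sqrt_le_sqrt hBA
  have hb0 : 0 ≤ b := Real.sqrt_nonneg _
  -- Here `b * a = √(#B * #A)`. Mixing between `B` and `A` bounds this product, and `#B = b * b ≤ b
  -- * a`.
  have h1 : (d : ℝ) / (2 * n) * (b * a) * (b * a) ≤ |lam| * (b * a) := by
    have e1 : (d : ℝ) * B.card * A.card / n = 2 * (d / (2 * n) * (b * a) * (b * a)) := by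
      rw [← ha2, ← hb2]
      field_simp
    have e2 : (B.card : ℝ) * (d / (2 * n) * A.card) = d / (2 * n) * (b * a) * (b * a) := by
      rw [← ha2, ← hb2]
      ring
    linarith
  have hbase : b * a ≤ 2 * |lam| * n / d := by
    rcases (mul_nonneg hb0 (hb0.trans hba)).eq_or_lt with h0 | h0
    · rw [← h0]
      positivity
    · have h2 := le_of_mul_le_mul_right h1 h0
      rw [le_div_iff₀ hd0]
      rw [div_mul_eq_mul_div, div_le_iff₀ (by positivity)] at h2
      linarith
  rw [← hb2]
  exact (mul_le_mul_of_nonneg_left hba hb0).trans hbase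

/-- Mixing between a vertex and itself, where there is no edge, gives `d / n ≤ |lam|`. -/
theorem IsNDLambdaGraph.one_le {n : ℕ} {G : SimpleGraph (Fin n)} [DecidableRel G.Adj]
    {d : ℕ} {lam : ℝ} (h : IsNDLambdaGraph G d lam) (hn : 0 < n) (hd : 0 < d) :
    1 ≤ 2 * |lam| * n / d := by
  have hn0 : (0 : ℝ) < n := Nat.cast_pos.2 hn
  have hd0 : (0 : ℝ) < d := Nat.cast_pos.2 hd
  have hmix := (abs_le.1 (h.expander_mixing {⟨0, hn⟩} {⟨0, hn⟩})).1
  simp only [Finset.sum_singleton, Finset.filter_singleton, G.irrefl, if_false, Finset.card_empty,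
    Finset.card_singleton, Nat.cast_zero, Nat.cast_one, Real.sqrt_one, mul_one, zero_sub,
    neg_le_neg_iff] at hmix
  rw [div_le_iff₀ hn0] at hmix
  rw [le_div_iff₀ hd0]
  have : 0 ≤ |lam| * n := by positivity
  linarith

/-- Alon and Rödl: the number of sequences of pairwise nonadjacent vertices. -/
theorem IsNDLambdaGraph.card_nonadjSeq_le {n : ℕ} {G : SimpleGraph (Fin n)} [DecidableRel G.Adj]
    {d : ℕ} {lam : ℝ} (h : IsNDLambdaGraph G d lam) (hn : 0 < n) (hd : 0 < d) (t : ℕ) :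
    ∀ (g : ℕ) (A : Finset (Fin n)), A.card * (1 - (d : ℝ) / (2 * n)) ^ g < 1 →
      ((nonadjSeq G t A).card : ℝ) ≤ 2 ^ t * (n : ℝ) ^ g * (2 * |lam| * n / d) ^ t := by
  classical
  have hdec : ‹DecidableRel G.Adj› = fun a b => Classical.propDecidable (G.Adj a b) :=
    Subsingleton.elim _ _
  subst hdec
  have hn1 : (1 : ℝ) ≤ n := Nat.one_le_cast.2 hn
  have hn0 : (0 : ℝ) < n := by linarith
  have hm1 := h.one_le hn hd
  set m := 2 * |lam| * n / d with hm
  have hdn : d < n := by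
    have h1 := G.degree_lt_card_verts ⟨0, hn⟩
    rwa [h.regular.degree_eq, Fintype.card_fin] at h1
  have hρ0 : 0 ≤ 1 - (d : ℝ) / (2 * n) := by
    rw [sub_nonneg, div_le_one (by positivity)]
    have : (d : ℝ) ≤ n := Nat.cast_le.2 hdn.le
    linarith
  -- The parameter `g` is a budget for vertices of `high`: each one shrinks the candidate set by the
  -- factor `1 - d / (2 * n)`, and at `g = 0` that set is empty. An entry from `low` has at most `m`
  -- choices and one from `high` at most `n`; the factor `2 ^ t` pays for the two kinds.
  induction t with
  | zero =>
    intro g A _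
    have : (nonadjSeq G 0 A).card ≤ 1 := by
      refine (Finset.card_le_univ _).trans ?_
      simp
    simp only [pow_zero, one_mul, mul_one]
    exact (Nat.cast_le.2 this).trans (by simpa using one_le_pow₀ hn1)
  | succ t ih =>
    intro g A hA
    set low := A.filter fun x => ((A.filter fun y => G.Adj x y).card : ℝ) <
      d / (2 * n) * A.card with hlow
    set high := A.filter fun x => ¬ ((A.filter fun y => G.Adj x y).card : ℝ) <
      d / (2 * n) * A.card with hhigh
    have hrec : ((nonadjSeq G (t + 1) A).card : ℝ) ≤
        ∑ v ∈ low, ((nonadjSeq G t (A.filter fun u => ¬ G.Adj v u)).card : ℝ) +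
          ∑ v ∈ high, ((nonadjSeq G t (A.filter fun u => ¬ G.Adj v u)).card : ℝ) := by
      rw [hlow, hhigh, Finset.sum_filter_add_sum_filter_not]
      exact_mod_cast card_nonadjSeq_succ_le G t A
    have hlowsum : ∑ v ∈ low, ((nonadjSeq G t (A.filter fun u => ¬ G.Adj v u)).card : ℝ) ≤
        m * (2 ^ t * (n : ℝ) ^ g * m ^ t) := by
      calc _ ≤ ∑ v ∈ low, (2 ^ t * (n : ℝ) ^ g * m ^ t) :=
            Finset.sum_le_sum fun v _ => (Nat.cast_le.2 (Finset.card_le_card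
              (nonadjSeq_mono G t (Finset.filter_subset _ _)))).trans (ih g A hA)
        _ = low.card * (2 ^ t * (n : ℝ) ^ g * m ^ t) := by rw [Finset.sum_const, nsmul_eq_mul]
        _ ≤ _ := by
            gcongr
            exact h.card_low_degree_le hn hd A
    have hhighsum : ∑ v ∈ high, ((nonadjSeq G t (A.filter fun u => ¬ G.Adj v u)).card : ℝ) ≤
        m * (2 ^ t * (n : ℝ) ^ g * m ^ t) := by
      cases g with
      | zero =>
        have : A.card = 0 := by
          rw [pow_zero, mul_one] at hA
          exact_mod_cast Nat.lt_one_iff.1 (by exact_mod_cast hA)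
        have hempty : high = ∅ := by
          rw [hhigh, Finset.card_eq_zero.1 this]
          rfl
        rw [hempty, Finset.sum_empty]
        positivity
      | succ g =>
        have hstep : ∀ v ∈ high,
            ((nonadjSeq G t (A.filter fun u => ¬ G.Adj v u)).card : ℝ) ≤
              2 ^ t * (n : ℝ) ^ g * m ^ t := by
          intro v hv
          refine ih g _ (lt_of_le_of_lt ?_ hA)
          have h1 := not_lt.1 (Finset.mem_filter.1 hv).2
          have h2 : ((A.filter fun y => G.Adj v y).card : ℝ) +
              (A.filter fun y => ¬ G.Adj v y).card = A.card := by
            exact_mod_cast Finset.card_filter_add_card_filter_not (s := A) fun y => G.Adj v y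
          rw [pow_succ', ← mul_assoc]
          gcongr
          linarith
        calc _ ≤ ∑ v ∈ high, (2 ^ t * (n : ℝ) ^ g * m ^ t) := Finset.sum_le_sum hstep
          _ = high.card * (2 ^ t * (n : ℝ) ^ g * m ^ t) := by rw [Finset.sum_const, nsmul_eq_mul]
          _ ≤ n * (2 ^ t * (n : ℝ) ^ g * m ^ t) := by
              gcongr
              simpa using Finset.card_le_univ high
          _ = 1 * (2 ^ t * (n : ℝ) ^ (g + 1) * m ^ t) := by ring
          _ ≤ _ := by gcongr
    calc ((nonadjSeq G (t + 1) A).card : ℝ) ≤ 2 * (m * (2 ^ t * (n : ℝ) ^ g * m ^ t)) := by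
          linarith
      _ = _ := by ring

/-- For such `t` the budget `g`, about `(2 * n / d) * log n`, satisfies `n ^ g ≤ e ^ t ≤ 3 ^ t`, and
`12 = 2 * 3 * 2`. -/
theorem IsNDLambdaGraph.card_nonadjSeq_univ_le {n : ℕ} {G : SimpleGraph (Fin n)}
    [DecidableRel G.Adj] {d : ℕ} {lam : ℝ} (h : IsNDLambdaGraph G d lam) (hn : 0 < n) (hd : 0 < d)
    {t : ℕ} (ht : (2 * n / d * Real.log n + 1) * Real.log n ≤ t) :
    ((nonadjSeq G t Finset.univ).card : ℝ) ≤ (12 * (|lam| / d) * n) ^ t := by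
  have hn1 : (1 : ℝ) ≤ n := Nat.one_le_cast.2 hn
  have hn0 : (0 : ℝ) < n := by linarith
  have hd0 : (0 : ℝ) < d := Nat.cast_pos.2 hd
  have hlog : 0 ≤ Real.log n := Real.log_nonneg hn1
  set g := ⌊2 * n / d * Real.log n⌋₊ + 1 with hg
  have hg1 : 2 * n / d * Real.log n < g := by
    rw [hg]
    push_cast
    exact Nat.lt_floor_add_one _
  have hg2 : (g : ℝ) ≤ 2 * n / d * Real.log n + 1 := by
    rw [hg]
    push_cast
    have := Nat.floor_le (show 0 ≤ 2 * n / d * Real.log n by positivity)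
    linarith
  have hdn : d < n := by
    have h1 := G.degree_lt_card_verts ⟨0, hn⟩
    rwa [h.regular.degree_eq, Fintype.card_fin] at h1
  have hρ0 : 0 ≤ 1 - (d : ℝ) / (2 * n) := by
    rw [sub_nonneg, div_le_one (by positivity)]
    have : (d : ℝ) ≤ n := Nat.cast_le.2 hdn.le
    linarith
  have hsmall : ((Finset.univ : Finset (Fin n)).card : ℝ) * (1 - (d : ℝ) / (2 * n)) ^ g < 1 := by
    rw [Finset.card_univ, Fintype.card_fin]
    have h1 : 1 - (d : ℝ) / (2 * n) ≤ Real.exp (-(d / (2 * n))) := by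
      have := Real.add_one_le_exp (-((d : ℝ) / (2 * n)))
      linarith
    calc (n : ℝ) * (1 - (d : ℝ) / (2 * n)) ^ g ≤ n * Real.exp (-(d / (2 * n))) ^ g := by gcongr
      _ = Real.exp (Real.log n - g * (d / (2 * n))) := by
          rw [← Real.exp_nat_mul, sub_eq_add_neg, Real.exp_add, Real.exp_log hn0]
          ring_nf
      _ < 1 := by
          rw [Real.exp_lt_one_iff, sub_neg]
          calc Real.log n = 2 * n / d * Real.log n * (d / (2 * n)) := by field_simp
            _ < g * (d / (2 * n)) := by gcongr
  have hng : (n : ℝ) ^ g ≤ 3 ^ t := by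
    calc (n : ℝ) ^ g = Real.exp (g * Real.log n) := by
          rw [Real.exp_nat_mul, Real.exp_log hn0]
      _ ≤ Real.exp (t * 1) := by
          apply Real.exp_le_exp.2
          rw [mul_one]
          exact (mul_le_mul_of_nonneg_right hg2 hlog).trans ht
      _ = Real.exp 1 ^ t := Real.exp_nat_mul _ _
      _ ≤ 3 ^ t := by
          gcongr
          linarith [Real.exp_one_lt_d9]
  calc ((nonadjSeq G t Finset.univ).card : ℝ) ≤ 2 ^ t * (n : ℝ) ^ g * (2 * |lam| * n / d) ^ t :=
        h.card_nonadjSeq_le hn hd t g _ hsmall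
    _ ≤ 2 ^ t * 3 ^ t * (2 * |lam| * n / d) ^ t := by gcongr
    _ = _ := by
        rw [← mul_pow, ← mul_pow]
        congr 1
        ring

/-! ### Overlaying random pullbacks -/

open Classical in
/-- Functions that map the members of a `t`-set `T` to pairwise nonadjacent vertices. -/
theorem card_nonadj_on_mul_le {N n t : ℕ} (G : SimpleGraph (Fin n)) (T : Finset (Fin N))
    (hT : T.card = t) :
    (Finset.univ.filter fun f : Fin N → Fin n => ∀ a ∈ T, ∀ b ∈ T, ¬ G.Adj (f a) (f b)).card *
      n ^ t ≤ (nonadjSeq G t Finset.univ).card * n ^ N := by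
  set e := (T.equivFinOfCardEq hT).symm with he
  have hcard : (Finset.univ.filter fun f : Fin N → Fin n =>
      ∀ a ∈ T, ∀ b ∈ T, ¬ G.Adj (f a) (f b)).card ≤
      (nonadjSeq G t Finset.univ ×ˢ (Finset.univ : Finset (↥(Tᶜ) → Fin n))).card := by
    refine Finset.card_le_card_of_injOn (fun f => (fun i => f (e i), fun a => f a)) ?_ ?_
    · intro f hf
      simp only [Finset.coe_filter, Finset.mem_univ, true_and, Set.mem_ofPred_eq] at hf
      simp only [nonadjSeq, Finset.mem_coe, Finset.mem_product, Finset.mem_filter, Finset.mem_univ,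
        true_and, and_true, implies_true]
      exact fun i j => hf _ (e i).2 _ (e j).2
    · intro f _ f' _ hff
      simp only [Prod.mk.injEq] at hff
      ext a
      by_cases ha : a ∈ T
      · have := congrFun hff.1 (e.symm ⟨a, ha⟩)
        simp only [Equiv.apply_symm_apply] at this
        rw [this]
      · have := congrFun hff.2 ⟨a, Finset.mem_compl.2 ha⟩
        simp only at this
        rw [this]
  have htN : t ≤ N := by
    rw [← hT]
    simpa using Finset.card_le_univ T
  rw [Finset.card_product, Finset.card_univ, Fintype.card_fun, Fintype.card_coe, Finset.card_compl,
    Fintype.card_fin, Fintype.card_fin, hT] at hcard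
  calc _ ≤ (nonadjSeq G t Finset.univ).card * n ^ (N - t) * n ^ t := Nat.mul_le_mul_right _ hcard
    _ = _ := by rw [mul_assoc, ← pow_add, Nat.sub_add_cancel htN]

open Classical in
/-- Some function to the vertices of `G` makes at most the expected number of members of a family
of `t`-sets nonadjacent. -/
theorem exists_fun_card_nonadj_le {N n t : ℕ} (hn : 0 < n) (G : SimpleGraph (Fin n))
    (F : Finset (Finset (Fin N))) (hF : ∀ T ∈ F, T.card = t) :
    ∃ f : Fin N → Fin n, (F.filter fun T => ∀ a ∈ T, ∀ b ∈ T, ¬ G.Adj (f a) (f b)).card * n ^ t ≤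
      (nonadjSeq G t Finset.univ).card * F.card := by
  have : Nonempty (Fin N → Fin n) := ⟨fun _ => ⟨0, hn⟩⟩
  have hsum : ∑ f : Fin N → Fin n,
      (F.filter fun T => ∀ a ∈ T, ∀ b ∈ T, ¬ G.Adj (f a) (f b)).card * n ^ t ≤
      ∑ f : Fin N → Fin n, (nonadjSeq G t Finset.univ).card * F.card := by
    have h := Finset.sum_card_bipartiteAbove_eq_sum_card_bipartiteBelow
      (s := (Finset.univ : Finset (Fin N → Fin n))) (t := F)
      (fun f T => ∀ a ∈ T, ∀ b ∈ T, ¬ G.Adj (f a) (f b))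
    simp only [Finset.bipartiteAbove, Finset.bipartiteBelow] at h
    rw [← Finset.sum_mul, h, Finset.sum_mul]
    calc _ ≤ ∑ T ∈ F, (nonadjSeq G t Finset.univ).card * n ^ N :=
          Finset.sum_le_sum fun T hT => card_nonadj_on_mul_le G T (hF T hT)
      _ = _ := by
          simp only [Finset.sum_const, smul_eq_mul, Finset.card_univ, Fintype.card_fun,
            Fintype.card_fin]
          ring
  obtain ⟨f, -, hf⟩ := Finset.exists_le_of_sum_le Finset.univ_nonempty hsum
  exact ⟨f, hf⟩

/-- Instead of independent random maps, the maps are chosen one color at a time: each is at least as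
good as average for the `t`-sets in `F'` that survive the earlier colors, and so cuts their number
by `p j ^ t`. -/
theorem exists_funs_card_nonadj_le {ι : Type*} {N t : ℕ} {n : ι → ℕ} (hn : ∀ i, 0 < n i)
    (G : ∀ i, SimpleGraph (Fin (n i))) (p : ι → ℝ) (hp : ∀ i, 0 ≤ p i)
    (hG : ∀ i, ((nonadjSeq (G i) t Finset.univ).card : ℝ) ≤ (p i * n i) ^ t)
    (F : Finset (Finset (Fin N))) (hF : ∀ T ∈ F, T.card = t) (s : Finset ι) :
    ∃ f : ∀ i, Fin N → Fin (n i), ∃ F' ⊆ F,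
      (∀ T ∈ F, (∀ i ∈ s, ∀ a ∈ T, ∀ b ∈ T, ¬ (G i).Adj (f i a) (f i b)) → T ∈ F') ∧
        (F'.card : ℝ) ≤ (∏ i ∈ s, p i) ^ t * F.card := by
  classical
  induction s using Finset.induction with
  | empty => exact ⟨fun i _ => ⟨0, hn i⟩, F, subset_rfl, fun T hT _ => hT, by simp⟩
  | insert j s hj ih =>
    obtain ⟨f, F', hF'F, hmem, hf⟩ := ih
    obtain ⟨f₀, hf₀⟩ := exists_fun_card_nonadj_le (hn j) (G j) F' fun T hT => hF T (hF'F hT)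
    have hnj : (0 : ℝ) < (n j : ℝ) ^ t := pow_pos (Nat.cast_pos.2 (hn j)) t
    refine ⟨Function.update f j f₀, _, (Finset.filter_subset _ _).trans hF'F, ?_,
      le_of_mul_le_mul_right (a := (n j : ℝ) ^ t)
        (le_trans (by exact_mod_cast hf₀) (?_ : ((nonadjSeq (G j) t Finset.univ).card : ℝ) *
          F'.card ≤ _)) hnj⟩
    · intro T hT hadj
      refine Finset.mem_filter.2 ⟨hmem T hT fun i hi => ?_, ?_⟩
      · have := hadj i (Finset.mem_insert_of_mem hi)
        rwa [Function.update_of_ne (ne_of_mem_of_not_mem hi hj)] at this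
      · have := hadj j (Finset.mem_insert_self j s)
        rwa [Function.update_self] at this
    · rw [Finset.prod_insert hj]
      calc _ ≤ (p j * n j) ^ t * ((∏ i ∈ s, p i) ^ t * F.card) :=
            mul_le_mul (hG j) hf (Nat.cast_nonneg _)
              (pow_nonneg (mul_nonneg (hp j) (Nat.cast_nonneg _)) _)
        _ = _ := by ring

/-- Graphs on the same vertex set yield an edge labeling, with one more color for the pairs that
are adjacent in none of them. -/
theorem exists_labeling {V : Type*} {k : ℕ} (H : Fin k → SimpleGraph V) :
    ∃ c : SimpleGraph.TopEdgeLabeling V (Fin (k + 1)),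
      (∀ i, c.labelGraph (Fin.castSucc i) ≤ H i) ∧
        ∀ a b, (c.labelGraph (Fin.last k)).Adj a b → ∀ i, ¬ (H i).Adj a b := by
  classical
  refine ⟨fun e => if h : ∃ i, e.1 ∈ (H i).edgeSet then h.choose.castSucc else Fin.last k, ?_, ?_⟩
  · intro i a b hab
    obtain ⟨hne, h⟩ := SimpleGraph.EdgeLabeling.labelGraph_adj a b |>.1 hab
    dsimp only at h
    split_ifs at h with hex
    · have := hex.choose_spec
      rwa [Fin.castSucc_injective _ h] at this
    · exact absurd h.symm (Fin.castSucc_lt_last i).ne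
  · intro a b hab i hi
    obtain ⟨hne, h⟩ := SimpleGraph.EdgeLabeling.labelGraph_adj a b |>.1 hab
    dsimp only at h
    rw [dif_pos ⟨i, hi⟩] at h
    exact (Fin.castSucc_lt_last _).ne h

/-- Overlaying random pullbacks of clique-free graphs with few independent sequences. -/
theorem exists_labeling_cliqueFree {k N t : ℕ} (s n : Fin k → ℕ) (hn : ∀ i, 0 < n i)
    (G : ∀ i, SimpleGraph (Fin (n i))) (hGs : ∀ i, (G i).CliqueFree (s i)) (p : Fin k → ℝ)
    (hp : ∀ i, 0 ≤ p i)
    (hG : ∀ i, ((nonadjSeq (G i) t Finset.univ).card : ℝ) ≤ (p i * n i) ^ t)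
    (hN : (N.choose t : ℝ) * (∏ i, p i) ^ t < 1) :
    ∃ c : SimpleGraph.TopEdgeLabeling (Fin N) (Fin (k + 1)),
      ∀ i, (c.labelGraph i).CliqueFree ((Fin.snoc s t : Fin (k + 1) → ℕ) i) := by
  classical
  obtain ⟨f, F', -, hmem, hf⟩ := exists_funs_card_nonadj_le hn G p hp hG
    (Finset.powersetCard t (Finset.univ : Finset (Fin N)))
    (fun T hT => (Finset.mem_powersetCard.1 hT).2) Finset.univ
  rw [Finset.card_powersetCard, Finset.card_univ, Fintype.card_fin, mul_comm] at hf
  have hempty := Finset.card_eq_zero.1 (Nat.lt_one_iff.1 (by exact_mod_cast hf.trans_lt hN))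
  obtain ⟨c, hc, hlast⟩ := exists_labeling fun i => (G i).comap (f i)
  refine ⟨c, fun i => ?_⟩
  refine Fin.lastCases ?_ (fun i => ?_) i
  · rw [Fin.snoc_last]
    intro T hT
    have hTF : T ∈ Finset.powersetCard t (Finset.univ : Finset (Fin N)) :=
      Finset.mem_powersetCard.2 ⟨Finset.subset_univ _, hT.2⟩
    have hTF' : T ∉ F' := by simp [hempty]
    refine hTF' (hmem T hTF fun i _ a ha b hb hab => ?_)
    rcases eq_or_ne a b with rfl | hne
    · exact (G i).irrefl hab
    · exact hlast a b (hT.1 ha hb hne) i hab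
  · rw [Fin.snoc_castSucc]
    intro T hT
    have hcl : ((G i).comap (f i)).IsClique T := hT.1.mono (hc i)
    -- The map need not be injective, but adjacent points of a pullback have distinct images, so
    -- cliques keep their size.
    have hinj : Set.InjOn (f i) T := by
      intro a ha b hb hab
      by_contra hne
      have := hcl ha hb hne
      rw [SimpleGraph.comap_adj, hab] at this
      exact (G i).irrefl this
    refine hGs i (T.image (f i)) ⟨?_, by rw [Finset.card_image_of_injOn hinj, hT.2]⟩
    intro x hx y hy hxy
    simp only [Finset.coe_image, Set.mem_image, Finset.mem_coe] at hx hy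
    obtain ⟨a, ha, rfl⟩ := hx
    obtain ⟨b, hb, rfl⟩ := hy
    exact hcl ha hb fun h => hxy (by rw [h])

/-! ### The lower bound -/

theorem tendsto_div_log_sq_atTop :
    Tendsto (fun t : ℕ => (t : ℝ) / Real.log t ^ 2) atTop atTop := by
  obtain ⟨M, hM1, hM⟩ := log_pow_le_mul_sqrt 2
  have h1 : Tendsto (fun t : ℕ => Real.sqrt t / M) atTop atTop :=
    (Real.tendsto_sqrt_atTop.comp tendsto_natCast_atTop_atTop).atTop_div_const (by linarith)
  refine tendsto_atTop_mono' _ ?_ h1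
  filter_upwards [eventually_ge_atTop 2] with t ht
  have ht1 : (1 : ℝ) < t := by exact_mod_cast ht
  have hlog : 0 < Real.log t := Real.log_pos ht1
  rw [div_le_div_iff₀ (by linarith) (by positivity)]
  have h2 := Real.mul_self_sqrt (show (0 : ℝ) ≤ t by linarith)
  calc Real.sqrt t * Real.log t ^ 2 ≤ Real.sqrt t * (M * Real.sqrt t) := by
        gcongr
        exact hM t ht1.le
    _ = t * M := by rw [← h2]; ring_nf; rw [Real.sq_sqrt]; linarith

/-- Weakly optimal graphs of a suitable order have few sequences of `t` pairwise nonadjacent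
vertices. -/
theorem WeaklyOptimalGraphsExist.exists_few_nonadjSeq {s : ℕ} (hs : 3 ≤ s) {α : ℝ}
    (h : WeaklyOptimalGraphsExist s α) :
    ∃ K : ℝ, 0 < K ∧ ∀ᶠ t : ℕ in atTop, ∃ n : ℕ, 0 < n ∧ ∃ G : SimpleGraph (Fin n),
      G.CliqueFree s ∧ ((nonadjSeq G t Finset.univ).card : ℝ) ≤
        (K * (Real.log t ^ 2 / t) ^ (s - 2) * n) ^ t := by
  classical
  obtain ⟨hα, d, lam, hex, hd, hlam⟩ := h
  obtain ⟨a, ha, hda⟩ := hd.2.exists_pos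
  obtain ⟨b, hb, hlb⟩ := hlam.1.exists_pos
  -- The order `n` will be about `(ε * t / log ^ 2 t) ^ (1 / α)`. Then `ε ≤ 1` gives `log n ≤ log t
  -- / α`, and `4 * a * ε ≤ α ^ 2` gives `(2 * n / d) * log ^ 2 n ≤ t / 2`, half of what the
  -- counting bound permits.
  set ε : ℝ := min 1 (α ^ 2 / (4 * a)) with hε
  have hε0 : 0 < ε := lt_min one_pos (by positivity)
  have hε1 : ε ≤ 1 := min_le_left _ _
  have hεa : 4 * a * ε ≤ α ^ 2 := by
    have := min_le_right 1 (α ^ 2 / (4 * a))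
    rw [← hε, le_div_iff₀ (by positivity)] at this
    linarith
  refine ⟨12 * (a * b * (2 ^ α / ε) ^ (s - 2)), by positivity, ?_⟩
  have hτ : Tendsto (fun t : ℕ => ε * ((t : ℝ) / Real.log t ^ 2)) atTop atTop :=
    tendsto_div_log_sq_atTop.const_mul_atTop hε0
  have hx : Tendsto (fun t : ℕ => (ε * ((t : ℝ) / Real.log t ^ 2)) ^ (1 / α)) atTop atTop :=
    (tendsto_rpow_atTop (by positivity)).comp hτ
  have hn := (tendsto_nat_floor_atTop (α := ℝ)).comp hx
  have hlogt : ∀ᶠ t : ℕ in atTop, 1 ≤ Real.log t :=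
    (Real.tendsto_log_atTop.comp tendsto_natCast_atTop_atTop).eventually_ge_atTop 1
  have hlogo : ∀ᶠ t : ℕ in atTop, Real.log t ≤ α / 2 * t := by
    have := (Real.isLittleO_log_id_atTop.bound (show 0 < α / 2 by positivity))
    filter_upwards [tendsto_natCast_atTop_atTop.eventually this] with t ht
    refine (le_abs_self _).trans ?_
    simpa using ht
  filter_upwards [hn.eventually hda.bound, hn.eventually hlb.bound, hn.eventually_ge_atTop 1,
    hτ.eventually_ge_atTop 1, hlogt, hlogo, eventually_ge_atTop 2] with t h1 h2 h3 h4 h5 h6 h7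
  simp only [Function.comp_apply] at h1 h2 h3
  set τ : ℝ := ε * ((t : ℝ) / Real.log t ^ 2) with hτdef
  set n : ℕ := ⌊τ ^ (1 / α)⌋₊ with hndef
  obtain ⟨G, hGs, hG⟩ := hex n
  refine ⟨n, h3, G, hGs, ?_⟩
  have hn1 : (1 : ℝ) ≤ n := Nat.one_le_cast.2 h3
  have hn0 : (0 : ℝ) < n := by linarith
  have ht0 : (0 : ℝ) < t := by positivity
  have hτ0 : 0 < τ := by linarith
  have hpow : ∀ y : ℝ, (0 : ℝ) < (n : ℝ) ^ y := fun y => Real.rpow_pos_of_pos hn0 y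
  rw [Real.norm_of_nonneg (hpow _).le, Real.norm_of_nonneg (Nat.cast_nonneg _)] at h1
  rw [Real.norm_of_nonneg (hpow _).le, Real.norm_eq_abs] at h2
  have hd0 : 0 < d n := by
    rcases Nat.eq_zero_or_pos (d n) with h0 | h0
    · rw [h0] at h1
      have := hpow (1 - α)
      simp only [Nat.cast_zero, mul_zero] at h1
      linarith
    · exact h0
  have hd0' : (0 : ℝ) < d n := Nat.cast_pos.2 hd0
  have hnα : (n : ℝ) ^ α ≤ τ := by
    calc (n : ℝ) ^ α ≤ (τ ^ (1 / α)) ^ α := by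
          refine Real.rpow_le_rpow hn0.le (Nat.floor_le ?_) hα.le
          positivity
      _ = τ := by rw [← Real.rpow_mul hτ0.le, one_div_mul_cancel hα.ne', Real.rpow_one]
  have hnα' : τ ≤ 2 ^ α * (n : ℝ) ^ α := by
    calc τ = (τ ^ (1 / α)) ^ α := by
          rw [← Real.rpow_mul hτ0.le, one_div_mul_cancel hα.ne', Real.rpow_one]
      _ ≤ (2 * n) ^ α := by
          refine Real.rpow_le_rpow (by positivity) ?_ hα.le
          have := (Nat.lt_floor_add_one (τ ^ (1 / α))).le
          rw [← hndef] at this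
          linarith
      _ = _ := Real.mul_rpow (by norm_num) hn0.le
  have hsplit : (n : ℝ) ^ (1 - α) * (n : ℝ) ^ α = n := by
    rw [← Real.rpow_add hn0]
    simp
  have hnd : (n : ℝ) / d n ≤ a * (n : ℝ) ^ α := by
    rw [div_le_iff₀ hd0']
    calc (n : ℝ) = (n : ℝ) ^ (1 - α) * (n : ℝ) ^ α := hsplit.symm
      _ ≤ a * d n * (n : ℝ) ^ α := by gcongr
      _ = _ := by ring
  have hτt : τ * Real.log t ^ 2 = ε * t := by
    rw [hτdef]
    field_simp
  have hlogn : Real.log n ≤ Real.log t / α := by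
    rw [le_div_iff₀ hα, mul_comm, ← Real.log_rpow hn0]
    refine Real.log_le_log (hpow _) (hnα.trans ?_)
    have : (1 : ℝ) ≤ Real.log t ^ 2 := one_le_pow₀ h5
    calc τ = τ * 1 := (mul_one _).symm
      _ ≤ τ * Real.log t ^ 2 := by gcongr
      _ = ε * t := hτt
      _ ≤ 1 * t := by gcongr
      _ = t := one_mul _
  have hlogn0 : 0 ≤ Real.log n := Real.log_nonneg hn1
  have hcond : (2 * (n : ℝ) / d n * Real.log n + 1) * Real.log n ≤ t := by
    have e1 : 2 * (n : ℝ) / d n * Real.log n * Real.log n ≤ t / 2 := by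
      calc 2 * (n : ℝ) / d n * Real.log n * Real.log n
          = 2 * ((n : ℝ) / d n) * Real.log n * Real.log n := by ring
        _ ≤ 2 * (a * τ) * (Real.log t / α) * (Real.log t / α) := by
            have : (n : ℝ) / d n ≤ a * τ := hnd.trans (by gcongr)
            gcongr
        _ = 2 * a * (τ * Real.log t ^ 2) / α ^ 2 := by
            field_simp
        _ = 4 * a * ε * t / (2 * α ^ 2) := by
            rw [hτt]
            field_simp
            ring
        _ ≤ α ^ 2 * t / (2 * α ^ 2) := by gcongr
        _ = t / 2 := by field_simp
    have e2 : Real.log n ≤ t / 2 := by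
      refine hlogn.trans ?_
      rw [div_le_iff₀ hα]
      linarith
    linarith
  refine (hG.card_nonadjSeq_univ_le h3 hd0 hcond).trans ?_
  -- Weak optimality enters here: `lam / d` is at most of order `(n ^ α)⁻¹ ^ (s - 2)`.
  have hexp : (n : ℝ) ^ (1 - ((s : ℝ) - 1) * α) =
      (n : ℝ) ^ (1 - α) * (((n : ℝ) ^ α)⁻¹) ^ (s - 2) := by
    rw [← Real.rpow_neg hn0.le, ← Real.rpow_mul_natCast hn0.le, ← Real.rpow_add hn0,
      Nat.cast_sub (by omega)]
    congr 1
    push_cast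
    ring
  have hinv : ((n : ℝ) ^ α)⁻¹ ≤ 2 ^ α / ε * (Real.log t ^ 2 / t) := by
    have : 2 ^ α / ε * (Real.log t ^ 2 / t) = 2 ^ α / τ := by
      rw [hτdef]
      field_simp
    rw [this, inv_eq_one_div, div_le_div_iff₀ (hpow _) hτ0, one_mul]
    exact hnα'
  have hratio : |lam n| / d n ≤ a * b * (2 ^ α / ε) ^ (s - 2) * (Real.log t ^ 2 / t) ^ (s - 2) := by
    rw [div_le_iff₀ hd0']
    calc |lam n| ≤ b * ((n : ℝ) ^ (1 - α) * (((n : ℝ) ^ α)⁻¹) ^ (s - 2)) := by rw [← hexp]; exact h2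
      _ ≤ b * (a * d n * (2 ^ α / ε * (Real.log t ^ 2 / t)) ^ (s - 2)) := by
          have := hpow (1 - α)
          have := hpow α
          gcongr
      _ = _ := by rw [mul_pow]; ring
  have : 12 * (|lam n| / d n) ≤
      12 * (a * b * (2 ^ α / ε) ^ (s - 2)) * (Real.log t ^ 2 / t) ^ (s - 2) := by linarith
  gcongr

/-- The lower bound for the Ramsey number, for large `t`. -/
theorem exists_eventually_le_ramseyNumber {k S : ℕ} (s : Fin k → ℕ) (α : Fin k → ℝ)
    (hs : ∀ i, 3 ≤ s i) (hS : ∑ i, (s i - 2) = S)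
    (h : ∀ i, WeaklyOptimalGraphsExist (s i) (α i)) :
    ∃ c : ℝ, 0 < c ∧ ∀ᶠ t : ℕ in atTop, ∀ N : ℕ,
      (∀ c : SimpleGraph.TopEdgeLabeling (Fin N) (Fin (k + 1)),
        ∃ i, ¬ (c.labelGraph i).CliqueFree ((Fin.snoc s t : Fin (k + 1) → ℕ) i)) →
      c * ((t : ℝ) ^ (S + 1) / Real.log t ^ (2 * S)) ≤ N := by
  choose K hK0 hK using fun i => (h i).exists_few_nonadjSeq (hs i)
  have hKpos : 0 < ∏ i, K i := Finset.prod_pos fun i _ => hK0 i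
  refine ⟨1 / (3 * ∏ i, K i), by positivity, ?_⟩
  filter_upwards [eventually_all.2 hK, eventually_ge_atTop 2] with t ht ht2 N hN
  choose n hn G hGs hG using ht
  by_contra hcon
  rw [not_le] at hcon
  have ht1 : (1 : ℝ) < t := by exact_mod_cast ht2
  have ht0 : (0 : ℝ) < t := by linarith
  have hlog : 0 < Real.log t := Real.log_pos ht1
  set y : ℝ := Real.log t ^ 2 / t with hy
  have hy0 : 0 < y := by positivity
  have hprod : ∏ i, K i * y ^ (s i - 2) = (∏ i, K i) * y ^ S := by
    rw [Finset.prod_mul_distrib, Finset.prod_pow_eq_pow_sum, hS]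
  -- The usual `(e * N / t) ^ t`, from `t ^ t / t! ≤ e ^ t`.
  have hchoose : (N.choose t : ℝ) ≤ (3 * N / t) ^ t := by
    have h1 := Real.pow_div_factorial_le_exp (t : ℝ) ht0.le t
    have h2 : Real.exp t ≤ 3 ^ t := by
      rw [← mul_one (t : ℝ), Real.exp_nat_mul]
      gcongr
      linarith [Real.exp_one_lt_d9]
    have h3 := h1.trans h2
    calc (N.choose t : ℝ) ≤ (N : ℝ) ^ t / (t.factorial : ℝ) := Nat.choose_le_pow_div t N
      _ = (N / t : ℝ) ^ t * ((t : ℝ) ^ t / (t.factorial : ℝ)) := by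
          rw [div_pow]
          field_simp
      _ ≤ (N / t : ℝ) ^ t * 3 ^ t := by gcongr
      _ = _ := by
          rw [← mul_pow]
          congr 1
          ring
  have hbase : 3 * N / t * ((∏ i, K i) * y ^ S) < 1 := by
    have e1 : (1 / (3 * ∏ i, K i) * ((t : ℝ) ^ (S + 1) / Real.log t ^ (2 * S))) *
        (3 / t * ((∏ i, K i) * y ^ S)) = 1 := by
      rw [hy, div_pow, ← pow_mul, pow_succ]
      field_simp
    calc 3 * N / t * ((∏ i, K i) * y ^ S) = N * (3 / t * ((∏ i, K i) * y ^ S)) := by ring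
      _ < (1 / (3 * ∏ i, K i) * ((t : ℝ) ^ (S + 1) / Real.log t ^ (2 * S))) *
          (3 / t * ((∏ i, K i) * y ^ S)) := by gcongr
      _ = 1 := e1
  obtain ⟨c, hc⟩ := exists_labeling_cliqueFree (N := N) (t := t) s n hn G hGs
    (fun i => K i * y ^ (s i - 2)) (fun i => by have := hK0 i; positivity) hG (by
      rw [hprod]
      calc (N.choose t : ℝ) * ((∏ i, K i) * y ^ S) ^ t
          ≤ (3 * N / t) ^ t * ((∏ i, K i) * y ^ S) ^ t := by gcongr
        _ = (3 * N / t * ((∏ i, K i) * y ^ S)) ^ t := (mul_pow _ _ _).symm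
        _ < 1 := pow_lt_one₀ (by positivity) hbase (by omega))
  obtain ⟨i, hi⟩ := hN c
  exact hi (hc i)

/-! ### Both bounds and uniform constants -/

/-- Both bounds for a fixed vector of clique sizes. -/
theorem exists_ramseyNumber_bounds {k S : ℕ} (s : Fin k → ℕ) (α : Fin k → ℝ)
    (hs : ∀ i, 3 ≤ s i) (hS : ∑ i, (s i - 2) = S)
    (h : ∀ i, WeaklyOptimalGraphsExist (s i) (α i)) :
    ∃ c C : ℝ, 0 < c ∧ 0 < C ∧ ∀ t : ℕ, 2 ≤ t →
      c * ((t : ℝ) ^ (S + 1) / Real.log t ^ (2 * S)) ≤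
          (ramseyNumber (Fin.snoc s t : Fin (k + 1) → ℕ) : ℝ) ∧
        (ramseyNumber (Fin.snoc s t : Fin (k + 1) → ℕ) : ℝ) ≤
          C * ((t : ℝ) ^ (S + 1) / Real.log t ^ S) := by
  obtain ⟨C, hC, hupper⟩ := exists_ramseyNumber_le s (fun i => (hs i).trans' (by norm_num)) hS
  obtain ⟨c₀, hc₀, hlower⟩ := exists_eventually_le_ramseyNumber s α hs hS h
  obtain ⟨t₀, ht₀⟩ := eventually_atTop.1 hlower
  set X : ℕ → ℝ := fun t => (t : ℝ) ^ (S + 1) / Real.log t ^ (2 * S) with hX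
  have hX0 : ∀ t, 0 ≤ X t := fun t =>
    div_nonneg (by positivity) ((even_two_mul S).pow_nonneg _)
  -- For the finitely many `t < t₀` it is enough that the Ramsey number is at least `1`; this
  -- constant makes `c₁ * X t ≤ 1` there.
  set c₁ : ℝ := 1 / (1 + ∑ t ∈ Finset.range t₀, X t) with hc₁
  have hsum : 0 ≤ ∑ t ∈ Finset.range t₀, X t := Finset.sum_nonneg fun t _ => hX0 t
  have hc₁0 : 0 < c₁ := by positivity
  refine ⟨min c₀ c₁, C, lt_min hc₀ hc₁0, hC, fun t ht => ⟨?_, (hupper t ht).2⟩⟩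
  obtain ⟨hpos, hr⟩ : 0 < ramseyNumber (Fin.snoc s t : Fin (k + 1) → ℕ) ∧ _ :=
    Nat.sInf_mem (hupper t ht).1
  change min c₀ c₁ * X t ≤ _
  rcases le_or_gt t₀ t with htt | htt
  · exact (mul_le_mul_of_nonneg_right (min_le_left _ _) (hX0 t)).trans (ht₀ t htt _ hr)
  · calc min c₀ c₁ * X t ≤ c₁ * X t := mul_le_mul_of_nonneg_right (min_le_right _ _) (hX0 t)
      _ ≤ 1 := by
          rw [hc₁, div_mul_eq_mul_div, one_mul, div_le_one (by positivity)]
          have := Finset.single_le_sum (fun t _ => hX0 t) (Finset.mem_range.2 htt)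
          linarith
      _ ≤ _ := by exact_mod_cast hpos

/-- The constants precede `s`: once `S` is fixed only finitely many vectors `s` are possible, and
the constants obtained for each of them can be combined. -/
theorem theorem3 (S k : ℕ) (α : Fin k → ℝ) :
    ∃ c C : ℝ, 0 < c ∧ 0 < C ∧
      ∀ s : Fin k → ℕ, (∀ i, 3 ≤ s i) → ∑ i, (s i - 2) = S →
        (∀ i, WeaklyOptimalGraphsExist (s i) (α i)) →
        ∀ t : ℕ, 2 ≤ t →
          c * ((t : ℝ) ^ (S + 1) / Real.log t ^ (2 * S)) ≤
              (ramseyNumber (Fin.snoc s t : Fin (k + 1) → ℕ) : ℝ) ∧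
            (ramseyNumber (Fin.snoc s t : Fin (k + 1) → ℕ) : ℝ) ≤
              C * ((t : ℝ) ^ (S + 1) / Real.log t ^ S) := by
  have hex : ∀ s : Fin k → ℕ, ∃ c C : ℝ, 0 < c ∧ 0 < C ∧ ((∀ i, 3 ≤ s i) →
      ∑ i, (s i - 2) = S → (∀ i, WeaklyOptimalGraphsExist (s i) (α i)) → ∀ t : ℕ, 2 ≤ t →
        c * ((t : ℝ) ^ (S + 1) / Real.log t ^ (2 * S)) ≤
            (ramseyNumber (Fin.snoc s t : Fin (k + 1) → ℕ) : ℝ) ∧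
          (ramseyNumber (Fin.snoc s t : Fin (k + 1) → ℕ) : ℝ) ≤
            C * ((t : ℝ) ^ (S + 1) / Real.log t ^ S)) := by
    intro s
    by_cases h : (∀ i, 3 ≤ s i) ∧ ∑ i, (s i - 2) = S ∧ ∀ i, WeaklyOptimalGraphsExist (s i) (α i)
    · obtain ⟨c, C, hc, hC, hb⟩ := exists_ramseyNumber_bounds s α h.1 h.2.1 h.2.2
      exact ⟨c, C, hc, hC, fun _ _ _ => hb⟩
    · exact ⟨1, 1, one_pos, one_pos, fun h1 h2 h3 => absurd ⟨h1, h2, h3⟩ h⟩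
  choose c C hc hC hb using hex
  -- Each `s i - 2` is at most `S`, so every admissible vector lies below `S + 2`.
  set A : Finset (Fin k → ℕ) := (Set.finite_Iic fun _ : Fin k => S + 2).toFinset with hA
  have hsumc : 0 ≤ ∑ s ∈ A, 1 / c s := Finset.sum_nonneg fun s _ => (one_div_pos.2 (hc s)).le
  have hsumC : 0 ≤ ∑ s ∈ A, C s := Finset.sum_nonneg fun s _ => (hC s).le
  refine ⟨1 / (1 + ∑ s ∈ A, 1 / c s), 1 + ∑ s ∈ A, C s, by positivity, by positivity,
    fun s hs hS hw t ht => ?_⟩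
  have hsA : s ∈ A := by
    rw [hA, Set.Finite.mem_toFinset, Set.mem_Iic]
    intro i
    have h1 := Finset.single_le_sum (f := fun i => s i - 2) (fun _ _ => Nat.zero_le _)
      (Finset.mem_univ i)
    dsimp only at h1 ⊢
    omega
  have ht1 : (1 : ℝ) < t := by exact_mod_cast ht
  have hlog : 0 < Real.log t := Real.log_pos ht1
  obtain ⟨hl, hu⟩ := hb s hs hS hw t ht
  refine ⟨le_trans ?_ hl, hu.trans ?_⟩
  · gcongr
    rw [one_div_le (by positivity) (hc s)]
    have := Finset.single_le_sum (fun s _ => (one_div_pos.2 (hc s)).le) hsA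
    linarith
  · gcongr
    have := Finset.single_le_sum (fun s _ => (hC s).le) hsA
    linarith
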